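/- A (finite) hypergraph $\mathcal H=(V,E)$ consists of a finite set $V$ and a set $E\subseteq\mathcal P(V)$ of edges. A join tree of $\mathcal H$ is a pair $(\mathcal T,\lambda)$ where $\mathcal T=(N,T)$ is a tree and $\lambda:N\to E$ is a bijection such that for each $v\in V$ the set $\{t\in N\mid v\in\lambda(t)\}$ is connected in $\mathcal T$ (possibly empty). A disjoint branches decomposition of $\mathcal H$ is a join tree $(\mathcal T,\lambda)$, rooted in some node, such that $\lambda(t)\cap\lambda(t')=\emptyset$ for any two nodes $t,t'$ appearing on different branches of $\mathcal T$ (that is, neither is an ancestor of the other). It is rooted in the edge $e$ if $\lambda(\text{root})=e$. There is a polynomial-time algorithm ComputeDB$(\mathcal H,e)$ that, given a hypergraph $\mathcal H=(V,E)$ and an edge $e\in E$, returns a disjoint branches decomposition of $\mathcal H$ rooted in $e$ if one exists and rejects otherwise. -/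

import Mathlib

namespace DisjointBranches

/-! ### Disjoint branches decompositions -/

/-- A join tree `(T, label)` of the hypergraph `H`. -/
structure JoinTree {α : Type} (H : Hypergraph α) where
  /-- the nodes of the tree -/
  Node : Type
  /-- the tree itself -/
  tree : SimpleGraph Node
  isTree : tree.IsTree
  /-- the bijection between the nodes of the tree and the hyperedges -/
  label : Node ≃ H.edgeSet
  /-- the connectedness condition; for a vertex that lies in no hyperedge the set is empty, which
  is allowed, whence `Preconnected` instead of `Connected` -/
  connectedness : ∀ v ∈ H.vertexSet, (tree.induce {t | v ∈ (label t : Set α)}).Preconnected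

namespace JoinTree

variable {α : Type} {H : Hypergraph α}

/-- `s` is an ancestor of `t` (or `t` itself) when the tree is rooted in `r`: it lies on the path
from `r` to `t`. -/
def IsAncestor (T : JoinTree H) (r s t : T.Node) : Prop :=
  ∃ p : T.tree.Walk r t, p.IsPath ∧ s ∈ p.support

/-- `s` and `t` appear on different branches of the tree rooted in `r`: neither of them is an
ancestor of the other, that is, no path from the root down to a leaf contains both. -/
def OnDifferentBranches (T : JoinTree H) (r s t : T.Node) : Prop :=
  ¬ T.IsAncestor r s t ∧ ¬ T.IsAncestor r t s

end JoinTree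

/-- A disjoint branches decomposition of `H`: a rooted join tree in which the hyperedges at nodes
on different branches are disjoint. -/
structure Decomposition {α : Type} (H : Hypergraph α) extends JoinTree H where
  root : Node
  disjoint_branches : ∀ s t : Node, toJoinTree.OnDifferentBranches root s t →
    (label s : Set α) ∩ (label t : Set α) = ∅

/-- The decomposition is rooted in the hyperedge `e`. -/
def Decomposition.RootedIn {α : Type} {H : Hypergraph α} (D : Decomposition H) (e : Set α) : Prop :=
  (D.label D.root : Set α) = e

/-! ### The machine model

Programs of a small first-order language that work on binary trees, with a step count.  It is the
usual WHILE language over binary trees (`nil`, `cons`, `hd`, `tl`, test for `nil`, sequencing,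
conditional, while loop), in a form without variables: each program reads one tree and returns one
tree, and `pair` is used to keep several values.  Every instruction that is executed costs at least
the size of the tree that it reads, and building a pair costs in addition the size of the result,
so that no value is ever larger than the time that has been spent (`Prog.Run.size_le`).  Polynomial
time in this model is therefore the same as polynomial time on multitape Turing machines. -/

/-- Binary trees, the data that programs work on. -/
inductive Dat : Type
  | nil : Dat
  | cons : Dat → Dat → Dat
  deriving DecidableEq

namespace Dat

/-- The size of a tree: its number of nodes and leaves. -/
def size : Dat → ℕ
  | nil => 1
  | cons a b => a.size + b.size + 1

/-- The first component of a pair. -/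
def head : Dat → Dat
  | nil => nil
  | cons a _ => a

/-- The second component of a pair. -/
def tail : Dat → Dat
  | nil => nil
  | cons _ b => b

/-- Booleans as trees; in tests, `nil` counts as false and every other tree as true. -/
def ofBool : Bool → Dat
  | false => nil
  | true => cons nil nil

/-- Lists of trees as trees. -/
def ofList : List Dat → Dat
  | [] => nil
  | a :: l => cons a (ofList l)

/-- Natural numbers in binary, as the list of their digits. -/
def ofNat (n : ℕ) : Dat := ofList ((Nat.bits n).map ofBool)

end Dat

/-- Programs. -/
inductive Prog : Type
  /-- return the input -/
  | id : Prog
  /-- return `nil` -/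
  | nil : Prog
  /-- return the first component of the input -/
  | hd : Prog
  /-- return the second component of the input -/
  | tl : Prog
  /-- is the input a pair of two equal trees? -/
  | eq : Prog
  /-- run `f` and `g` on the input and return the pair of their results -/
  | pair (f g : Prog) : Prog
  /-- run `f`, then run `g` on the result -/
  | seq (f g : Prog) : Prog
  /-- run `f` or `g` on the input, according to the result of the test `c` on the input -/
  | cond (c f g : Prog) : Prog
  /-- while the test `c` is true on the current tree, replace this tree by the result of `f` -/
  | loop (c f : Prog) : Prog

/-- `p.Run x y t`: on input `x`, the program `p` halts after `t` steps with output `y`. -/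
inductive Prog.Run : Prog → Dat → Dat → ℕ → Prop
  | id (x : Dat) : Run .id x x x.size
  | nil (x : Dat) : Run .nil x .nil x.size
  | hd (x : Dat) : Run .hd x x.head x.size
  | tl (x : Dat) : Run .tl x x.tail x.size
  | eq_true (a : Dat) : Run .eq (.cons a a) (.ofBool true) (Dat.cons a a).size
  | eq_false (x : Dat) (h : ∀ a, x ≠ .cons a a) : Run .eq x (.ofBool false) x.size
  | pair {f g : Prog} {x y z : Dat} {s t : ℕ} (hf : Run f x y s) (hg : Run g x z t) :
      Run (.pair f g) x (.cons y z) (s + t + x.size + (Dat.cons y z).size)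
  | seq {f g : Prog} {x y z : Dat} {s t : ℕ} (hf : Run f x y s) (hg : Run g y z t) :
      Run (.seq f g) x z (s + t + x.size)
  | cond_true {c f g : Prog} {x b y : Dat} {s t : ℕ} (hc : Run c x b s) (hb : b ≠ .nil)
      (hf : Run f x y t) : Run (.cond c f g) x y (s + t + x.size)
  | cond_false {c f g : Prog} {x y : Dat} {s t : ℕ} (hc : Run c x .nil s)
      (hg : Run g x y t) : Run (.cond c f g) x y (s + t + x.size)
  | loop_stop {c f : Prog} {x : Dat} {s : ℕ} (hc : Run c x .nil s) :
      Run (.loop c f) x x (s + x.size)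
  | loop_step {c f : Prog} {x b y z : Dat} {s t u : ℕ} (hc : Run c x b s) (hb : b ≠ .nil)
      (hf : Run f x y t) (hl : Run (.loop c f) y z u) :
      Run (.loop c f) x z (s + t + u + x.size)

/-- Programs are deterministic: output and running time are determined by the input. -/
theorem Prog.Run.unique {p : Prog} {x y y' : Dat} {t t' : ℕ} (h : p.Run x y t)
    (h' : p.Run x y' t') : y = y' ∧ t = t' := by
  induction h generalizing y' t' with
  | id | nil | hd | tl => cases h'; exact ⟨rfl, rfl⟩
  | eq_true a =>
    cases h' with
    | eq_true => exact ⟨rfl, rfl⟩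
    | eq_false _ h => exact absurd rfl (h a)
  | eq_false x h =>
    cases h' with
    | eq_true a => exact absurd rfl (h a)
    | eq_false => exact ⟨rfl, rfl⟩
  | pair _ _ ihf ihg =>
    cases h' with
    | pair hf hg =>
      obtain ⟨rfl, rfl⟩ := ihf hf
      obtain ⟨rfl, rfl⟩ := ihg hg
      exact ⟨rfl, rfl⟩
  | seq _ _ ihf ihg =>
    cases h' with
    | seq hf hg =>
      obtain ⟨rfl, rfl⟩ := ihf hf
      obtain ⟨rfl, rfl⟩ := ihg hg
      exact ⟨rfl, rfl⟩
  | cond_true _ hb _ ihc ihf =>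
    cases h' with
    | cond_true hc _ hf =>
      obtain ⟨rfl, rfl⟩ := ihc hc
      obtain ⟨rfl, rfl⟩ := ihf hf
      exact ⟨rfl, rfl⟩
    | cond_false hc _ => exact absurd (ihc hc).1 hb
  | cond_false _ _ ihc ihg =>
    cases h' with
    | cond_true hc hb _ => exact absurd (ihc hc).1.symm hb
    | cond_false hc hg =>
      obtain ⟨_, rfl⟩ := ihc hc
      obtain ⟨rfl, rfl⟩ := ihg hg
      exact ⟨rfl, rfl⟩
  | loop_stop _ ihc =>
    cases h' with
    | loop_stop hc =>
      obtain ⟨_, rfl⟩ := ihc hc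
      exact ⟨rfl, rfl⟩
    | loop_step hc hb _ _ => exact absurd (ihc hc).1.symm hb
  | loop_step _ hb _ _ ihc ihf ihl =>
    cases h' with
    | loop_stop hc => exact absurd (ihc hc).1 hb
    | loop_step hc _ hf hl =>
      obtain ⟨rfl, rfl⟩ := ihc hc
      obtain ⟨rfl, rfl⟩ := ihf hf
      obtain ⟨rfl, rfl⟩ := ihl hl
      exact ⟨rfl, rfl⟩

/-- The output is not larger than the running time. -/
theorem Prog.Run.size_le {p : Prog} {x y : Dat} {t : ℕ} (h : p.Run x y t) : y.size ≤ t := by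
  induction h with
  | nil x | hd x | tl x => cases x <;> simp [Dat.size, Dat.head, Dat.tail] <;> omega
  | eq_false x h => cases x <;> simp [Dat.size, Dat.ofBool]
  | eq_true a => cases a <;> simp [Dat.size, Dat.ofBool] <;> omega
  | _ => omega

/-! ### Representing finite objects as data

`Rep d a` says that the tree `d` is a representation of the object `a`.  Finite sets are represented
by listing their elements without repetition, in any order. -/

/-- Representation of natural numbers. -/
def RepNat (d : Dat) (n : ℕ) : Prop := d = Dat.ofNat n

/-- Representation of (finite) sets of objects, from a representation of these objects. -/
def RepSet {β : Type} (Rep : Dat → β → Prop) (d : Dat) (S : Set β) : Prop :=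
  ∃ (l : List β) (ds : List Dat), l.Nodup ∧ (∀ b, b ∈ l ↔ b ∈ S) ∧ List.Forall₂ Rep ds l ∧
    d = Dat.ofList ds

/-- Representation of unordered pairs of objects, as ordered pairs in one of the two orders. -/
def RepSym2 {β : Type} (Rep : Dat → β → Prop) (d : Dat) (z : Sym2 β) : Prop :=
  ∃ (a b : β) (da db : Dat), z = s(a, b) ∧ Rep da a ∧ Rep db b ∧ d = Dat.cons da db

/-- Representation of hypergraphs: the list of vertices and the list of hyperedges, each hyperedge
given as the list of its vertices. -/
def RepHypergraph (d : Dat) (H : Hypergraph ℕ) : Prop :=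
  ∃ dV dE : Dat, RepSet RepNat dV H.vertexSet ∧ RepSet (RepSet RepNat) dE H.edgeSet ∧
    d = Dat.cons dV dE

/-- Representation of a hypergraph together with one of its hyperedges. -/
def RepInstance (d : Dat) (H : Hypergraph ℕ) (e : Set ℕ) : Prop :=
  ∃ dH de : Dat, RepHypergraph dH H ∧ RepSet RepNat de e ∧ d = Dat.cons dH de

/-- Representation of disjoint branches decompositions: the root, the list of all nodes of the tree
and the list of all edges of the tree, where a node is written as the hyperedge at this node. -/
def RepDecomposition {H : Hypergraph ℕ} (d : Dat) (D : Decomposition H) : Prop :=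
  ∃ dr dN dT : Dat,
    RepSet RepNat dr (D.label D.root : Set ℕ) ∧
    RepSet (fun d t => RepSet RepNat d (D.label t : Set ℕ)) dN Set.univ ∧
    RepSet (RepSym2 (fun d t => RepSet RepNat d (D.label t : Set ℕ))) dT D.tree.edgeSet ∧
    d = Dat.cons dr (Dat.cons dN dT)

/-- The answer by which a program rejects; it is not a representation of a decomposition. -/
def reject : Dat := Dat.nil

end DisjointBranches

/-! Hyperedges that meet must be comparable in the ancestor order, so a decomposition rooted in `e`
directs every intersecting pair. Convexity along branches yields rules by which one directed pair
forces another (`Closed`). Conversely, a closed relation that directs all intersecting pairs and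
stays acyclic after adding the pairs `(e, x)` generates an ancestor order (`branchOrder_of_closed`),
and its covering pairs form the required tree (`BranchOrder.decomposition`). What remains is to find
an `Orientation` of the intersecting pairs with `e` as a source.

This is done greedily. A closed relation `D` is kept; an element `p` is made a source of the pairs
that are still open, the result is closed under the rules, and it is kept unless some element
becomes related to itself. No backtracking is needed, for two reasons. Safety
(`exists_orientation_of_sourceAt`): if `D` lies in an orientation `L` and the new closure is
irreflexive, then this closure, completed by `L` on the pairs left open, is again an orientation.
All rules but transitivity survive because their forcing is reversible; transitivity and acyclicity
reduce to the absence of cyclic triangles, whose hard case is `closure_sourceAt_triangle`. Progress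
(`exists_sourceAt_le`): an `L`-minimal endpoint of an open pair can always be made a source. Hence a
sweep over all elements that changes nothing leaves no pair open.

All relations are sublists of the list of all pairs and only grow, so as many rounds as there are
pairs reach a fixed point (`repeated_fixed`). The same size bound makes the iterations polynomial
(`PolyTime.foldl`). -/

namespace DisjointBranches

/-! ### Orientations of the intersection graph -/

section Orientation

variable {ι α : Type*} {A : ι → Set α}

/-- The sets with indices `i` and `j` intersect. -/
def Meet (A : ι → Set α) (i j : ι) : Prop := (A i ∩ A j).Nonempty

theorem Meet.symm {i j : ι} (h : Meet A i j) : Meet A j i := by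
  rwa [Meet, Set.inter_comm]

/-- A relation between intersecting sets that is closed under the implications that hold for
the order of an ancestor relation restricted to intersecting sets. -/
structure Closed (A : ι → Set α) (D : ι → ι → Prop) : Prop where
  meet : ∀ {x y}, D x y → Meet A x y
  away : ∀ {x y z}, D x y → Meet A y z → ¬ Meet A x z → D y z
  head : ∀ {x y z}, D x y → Meet A z y → ¬ A x ∩ A z ⊆ A y → D z y
  tail : ∀ {x y z}, D x y → Meet A x z → ¬ A y ∩ A z ⊆ A x → D x z
  trans : ∀ {x y z}, D x y → D y z → Meet A x z → D x z

/-- The smallest closed relation that contains `R` (restricted to intersecting sets). -/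
inductive Closure (A : ι → Set α) (R : ι → ι → Prop) : ι → ι → Prop
  | base {x y} : R x y → Meet A x y → Closure A R x y
  | away {x y z} : Closure A R x y → Meet A y z → ¬ Meet A x z → Closure A R y z
  | head {x y z} : Closure A R x y → Meet A z y → ¬ A x ∩ A z ⊆ A y → Closure A R z y
  | tail {x y z} : Closure A R x y → Meet A x z → ¬ A y ∩ A z ⊆ A x → Closure A R x z
  | trans {x y z} : Closure A R x y → Closure A R y z → Meet A x z → Closure A R x z

theorem Closure.closed (R : ι → ι → Prop) : Closed A (Closure A R) where
  meet h := by cases h <;> assumption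
  away := .away
  head := .head
  tail := .tail
  trans := .trans

theorem Closure.le {R D : ι → ι → Prop} (hD : Closed A D) (h : ∀ x y, R x y → Meet A x y → D x y)
    {x y : ι} (hxy : Closure A R x y) : D x y := by
  induction hxy with
  | base h' hm => exact h _ _ h' hm
  | away _ h₁ h₂ ih => exact hD.away ih h₁ h₂
  | head _ h₁ h₂ ih => exact hD.head ih h₁ h₂
  | tail _ h₁ h₂ ih => exact hD.tail ih h₁ h₂
  | trans _ _ h ih₁ ih₂ => exact hD.trans ih₁ ih₂ h

/-- The intersecting sets `x` and `y` are not ordered by `D`. -/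
def Open (A : ι → Set α) (D : ι → ι → Prop) (x y : ι) : Prop :=
  Meet A x y ∧ x ≠ y ∧ ¬ D x y ∧ ¬ D y x

theorem Open.symm {D : ι → ι → Prop} {x y : ι} (h : Open A D x y) : Open A D y x :=
  ⟨h.1.symm, h.2.1.symm, h.2.2.2, h.2.2.1⟩

/-- A closed acyclic relation that compares any two distinct intersecting sets. -/
structure Orientation (A : ι → Set α) (L : ι → ι → Prop) : Prop extends Closed A L where
  total : ∀ {x y}, Meet A x y → x ≠ y → L x y ∨ L y x
  acyclic : ∀ x, ¬ Relation.TransGen L x x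

namespace Orientation

variable {L : ι → ι → Prop}

theorem irrefl (hL : Orientation A L) (x : ι) : ¬ L x x := fun h => hL.acyclic x (.single h)

theorem asymm (hL : Orientation A L) {x y : ι} (h : L x y) : ¬ L y x :=
  fun h' => hL.acyclic x (.tail (.single h) h')

/-- Two predecessors of an element intersect. -/
theorem meet_of_common (hL : Orientation A L) {x y z : ι} (hx : L x z) (hy : L y z) :
    Meet A x y := by
  by_contra h
  exact hL.asymm (hL.away hx (hL.meet hy).symm h) hy

theorem exists_minimal [Finite ι] (hL : Orientation A L) (s : Set ι) (hs : s.Nonempty) :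
    ∃ m ∈ s, ∀ x ∈ s, ¬ L x m := by
  have : Std.Irrefl (Relation.TransGen L) := ⟨hL.acyclic⟩
  have : IsTrans ι (Relation.TransGen L) := ⟨fun _ _ _ => Relation.TransGen.trans⟩
  have hw : WellFounded (Relation.TransGen L) := Finite.wellFounded_of_trans_of_irrefl _
  exact ⟨hw.min s hs, hw.min_mem s hs, fun x hx h => hw.not_lt_min s hx (.single h)⟩

theorem exists_maximal [Finite ι] (hL : Orientation A L) (s : Set ι) (hs : s.Nonempty) :
    ∃ m ∈ s, ∀ x ∈ s, ¬ L m x := by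
  have : Std.Irrefl (Function.swap (Relation.TransGen L)) := ⟨hL.acyclic⟩
  have : IsTrans ι (Function.swap (Relation.TransGen L)) :=
    ⟨fun _ _ _ h₁ h₂ => Relation.TransGen.trans h₂ h₁⟩
  have hw : WellFounded (Function.swap (Relation.TransGen L)) :=
    Finite.wellFounded_of_trans_of_irrefl _
  exact ⟨hw.min s hs, hw.min_mem s hs, fun x hx h => hw.not_lt_min s hx (.single h)⟩

end Orientation

/-- On a cycle through `x`, every element has a predecessor that again lies on a cycle through `x`,
so these elements form a set without a minimal element. -/
theorem acyclic_of_exists_minimal {D : ι → ι → Prop}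
    (h : ∀ s : Set ι, s.Nonempty → ∃ m ∈ s, ∀ x ∈ s, ¬ D x m) (x : ι) :
    ¬ Relation.TransGen D x x := by
  intro hx
  obtain ⟨m, hm, hm'⟩ := h {y | Relation.TransGen D x y ∧ Relation.TransGen D y x} ⟨x, hx, hx⟩
  obtain ⟨y, hy, hym⟩ := Relation.TransGen.tail'_iff.mp hm.1
  refine hm' y ⟨?_, (Relation.TransGen.single hym).trans hm.2⟩ hym
  obtain rfl | hy := Relation.reflTransGen_iff_eq_or_transGen.mp hy
  · exact hx
  · exact hy

/-- The relation `D`, extended by `L` on the pairs that `D` leaves open. -/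
def Merge (A : ι → Set α) (D L : ι → ι → Prop) (x y : ι) : Prop :=
  D x y ∨ Open A D x y ∧ L x y

/-! ### Completing a closed relation by an orientation -/

section Merge

variable {D L : ι → ι → Prop}

theorem merge_total (hL : Orientation A L) {x y : ι} (h : Meet A x y) (hne : x ≠ y) :
    Merge A D L x y ∨ Merge A D L y x := by
  by_cases h₁ : D x y
  · exact .inl (.inl h₁)
  by_cases h₂ : D y x
  · exact .inr (.inl h₂)
  have ho : Open A D x y := ⟨h, hne, h₁, h₂⟩
  exact (hL.total h hne).imp (fun h => .inr ⟨ho, h⟩) (fun h => .inr ⟨ho.symm, h⟩)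

/-- A set that meets another is nonempty and so meets itself, whence `trans` applies to `x`, `y`,
`x`. Irreflexivity is therefore the only contradiction that the algorithm has to test for. -/
theorem closed_asymm (hD : Closed A D) (hirr : ∀ x, ¬ D x x) {x y : ι} (h : D x y) : ¬ D y x := by
  intro h'
  have hm := hD.meet h
  exact hirr x (hD.trans h h' ⟨hm.some, hm.some_mem.1, hm.some_mem.1⟩)

theorem merge_asymm (hL : Orientation A L) (hD : Closed A D) (hirr : ∀ x, ¬ D x x) {x y : ι}
    (h : Merge A D L x y) : ¬ Merge A D L y x := by
  rintro (h' | ⟨h', h''⟩) <;> rcases h with h | ⟨ho, hl⟩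
  · exact closed_asymm hD hirr h h'
  · exact ho.2.2.2 h'
  · exact h'.2.2.2 h
  · exact hL.asymm hl h''

theorem merge_meet (hD : Closed A D) {x y : ι} (h : Merge A D L x y) : Meet A x y := by
  rcases h with h | h
  · exact hD.meet h
  · exact h.1.1

/-- The rule is its own converse: `z` before `y` forces `y` before `x`. So `D` settles both pairs or
neither, and in the latter case the rule is inherited from `L`. -/
theorem merge_away (hL : Orientation A L) (hD : Closed A D) (hirr : ∀ x, ¬ D x x) {x y z : ι}
    (h : Merge A D L x y) (hm : Meet A y z) (hn : ¬ Meet A x z) : Merge A D L y z := by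
  have hxy := merge_meet hD h
  have hyz : y ≠ z := by rintro rfl; exact hn hxy
  refine (merge_total hL hm hyz).resolve_right fun h' => ?_
  rcases h with h | ⟨ho, hl⟩
  · have := hD.away h hm hn
    exact merge_asymm hL hD hirr (.inl this) h'
  · rcases h' with h' | ⟨ho', hl'⟩
    · exact ho.2.2.2 (hD.away h' hxy.symm fun h => hn h.symm)
    · exact hL.asymm (hL.away hl hm hn) hl'

/-- As for `merge_away`; the converse of the rule `head` is the rule `tail`, and vice versa in
`merge_tail`. -/
theorem merge_head (hL : Orientation A L) (hD : Closed A D) (hirr : ∀ x, ¬ D x x) {x y z : ι}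
    (h : Merge A D L x y) (hm : Meet A z y) (hn : ¬ A x ∩ A z ⊆ A y) : Merge A D L z y := by
  have hxy := merge_meet hD h
  have hzy : z ≠ y := by rintro rfl; exact hn Set.inter_subset_right
  refine (merge_total hL hm hzy).resolve_right fun h' => ?_
  rcases h with h | ⟨ho, hl⟩
  · exact merge_asymm hL hD hirr (.inl (hD.head h hm hn)) h'
  · rcases h' with h' | ⟨ho', hl'⟩
    · exact ho.2.2.2 (hD.tail h' hxy.symm fun h => hn (by rwa [Set.inter_comm]))
    · exact hL.asymm (hL.head hl hm hn) hl'

theorem merge_tail (hL : Orientation A L) (hD : Closed A D) (hirr : ∀ x, ¬ D x x) {x y z : ι}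
    (h : Merge A D L x y) (hm : Meet A x z) (hn : ¬ A y ∩ A z ⊆ A x) : Merge A D L x z := by
  have hxy := merge_meet hD h
  have hxz : x ≠ z := by rintro rfl; exact hn Set.inter_subset_right
  refine (merge_total hL hm hxz).resolve_right fun h' => ?_
  rcases h with h | ⟨ho, hl⟩
  · exact merge_asymm hL hD hirr (.inl (hD.tail h hm hn)) h'
  · rcases h' with h' | ⟨ho', hl'⟩
    · exact ho.2.2.2 (hD.head h' hxy.symm fun h => hn (by rwa [Set.inter_comm]))
    · exact hL.asymm (hL.tail hl hm hn) hl'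

/-- If `Merge A D L` has no cyclic triangles, then it is an orientation. -/
theorem merge_orientation [Finite ι] (hL : Orientation A L) (hD : Closed A D)
    (hirr : ∀ x, ¬ D x x)
    (htri : ∀ x y z, Merge A D L x y → Merge A D L y z → ¬ Merge A D L z x) :
    Orientation A (Merge A D L) := by
  have htrans : ∀ {x y z}, Merge A D L x y → Merge A D L y z → Meet A x z →
      Merge A D L x z := by
    intro x y z h₁ h₂ hm
    refine (merge_total hL hm ?_).resolve_right (htri x y z h₁ h₂)
    rintro rfl
    exact merge_asymm hL hD hirr h₁ h₂
  refine ⟨⟨merge_meet hD, merge_away hL hD hirr, merge_head hL hD hirr, merge_tail hL hD hirr,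
    htrans⟩, merge_total hL, acyclic_of_exists_minimal ?_⟩
  intro s hs
  have hfin : s.Finite := s.toFinite
  induction hn : s.ncard generalizing s with
  | zero => simp [hfin, hs.ne_empty] at hn
  | succ n ih =>
    -- Since `z` is `L`-maximal, all elements of `s` that meet `z` are `L`-before it and hence meet
    -- each other. So if `y` precedes `z` and `z` precedes a minimal `m` of the rest, then `y`
    -- precedes `m`, which is impossible.
    obtain ⟨z, hz, hzmax⟩ := hL.exists_maximal s hs
    by_cases hz' : ∀ x ∈ s, ¬ Merge A D L x z
    · exact ⟨z, hz, hz'⟩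
    push Not at hz'
    obtain ⟨y, hy, hyz⟩ := hz'
    have hne : ∀ {x}, x ∈ s → Meet A x z → x ≠ z → L x z := fun hx hm hne =>
      (hL.total hm hne).resolve_right (hzmax _ hx)
    have hyz' : y ≠ z := by
      rintro rfl; exact merge_asymm hL hD hirr hyz hyz
    obtain ⟨m, hm, hmin⟩ := ih (s \ {z}) ⟨y, hy, hyz'⟩ (Set.toFinite _)
      (by rw [Set.ncard_sdiff_singleton_of_mem hz, hn]; rfl)
    refine ⟨m, hm.1, fun x hx hxm => ?_⟩
    by_cases hxz : x = z
    · subst hxz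
      have h₁ := hne hy (merge_meet hD hyz) hyz'
      have h₂ := hne hm.1 (merge_meet hD hxm).symm hm.2
      exact hmin y ⟨hy, hyz'⟩ (htrans hyz hxm (hL.meet_of_common h₁ h₂))
    · exact hmin x ⟨hx, hxz⟩ hxm

end Merge

/-- `D` together with all pairs `(p, j)` that are left open by `D`. -/
def SourceAt (A : ι → Set α) (D : ι → ι → Prop) (p x y : ι) : Prop :=
  D x y ∨ x = p ∧ Open A D x y

/-- Induction on the derivation of the new pair `(f, g)`, for all third vertices `h` at once. In
each case either a rule settles one of the pairs that should be open, or the premise of the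
derivation forms a cyclic triangle with the same `h`. The pair must not lie in `D`, since otherwise
the base case would give no information. -/
theorem closure_sourceAt_triangle {D L : ι → ι → Prop} {p : ι} (hD : Closed A D)
    (hL : Orientation A L) (hDL : ∀ x y, D x y → L x y)
    {f g : ι} (hfg : Closure A (SourceAt A D p) f g) :
    ¬ D f g → ∀ h, Open A (Closure A (SourceAt A D p)) h f →
      Open A (Closure A (SourceAt A D p)) h g → L g h → ¬ L h f := by
  have hC := Closure.closed (A := A) (SourceAt A D p)
  have hDC : ∀ x y, D x y → Closure A (SourceAt A D p) x y :=
    fun x y h => .base (.inl h) (hD.meet h)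
  induction hfg with
  | @base x y hs hm =>
    intro hn h hf hg _ _
    rcases hs with hs | ⟨rfl, _⟩
    · exact hn hs
    -- Here `f` is the new source, so the pair `(f, h)` cannot have stayed open.
    · exact hf.2.2.2 (.base (.inr ⟨rfl, hf.1.symm, hf.2.1.symm, fun h' => hf.2.2.2 (hDC _ _ h'),
        fun h' => hf.2.2.1 (hDC _ _ h')⟩) hf.1.symm)
  | @away x f g hx hfg hxg ih =>
    intro _ h hf hg _ _
    have hfh : A f ∩ A h ⊆ A g := by
      by_contra hc; exact hg.2.2.1 (hC.head (.away hx hfg hxg) hg.1 hc)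
    by_cases hxh : Meet A x h
    · have hxhf : A x ∩ A h ⊆ A f := by
        by_contra hc; exact hf.2.2.1 (hC.head hx hf.1 hc)
      obtain ⟨v, hv⟩ := hxh
      exact hxg ⟨v, hv.1, hfh ⟨hxhf hv, hv.2⟩⟩
    · exact hf.2.2.2 (hC.away hx hf.1.symm hxh)
  | @head f' g f hf' hfg hn ih =>
    intro hnD h hf hg hgh hhf
    have hfg' := hC.head hf' hfg hn
    have hfh : A f ∩ A h ⊆ A g := by
      by_contra hc; exact hg.2.2.1 (hC.head hfg' hg.1 hc)
    have hnh : ¬ A f' ∩ A f ⊆ A h := fun hc => hn fun v hv => hfh ⟨hv.2, hc hv⟩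
    by_cases hm : Meet A f' h
    swap
    · exact hg.2.2.2 (hC.away hf' hg.1.symm hm)
    -- As `A f' ∩ A f` is not contained in `A h`, the pairs `(h, f)` and `(h, f')` force each other,
    -- so `f'` takes the place of `f`.
    have ho : Open A (Closure A (SourceAt A D p)) h f' := by
      refine ⟨hm.symm, ?_, ?_, ?_⟩
      · rintro rfl; exact hg.2.2.1 hf'
      · intro hc
        exact hf.2.2.1 (hC.tail hc hf.1 hnh)
      · intro hc
        exact hf.2.2.2 (hC.head hc hf.1.symm hnh)
    exact ih (fun hc => hnD (hD.head hc hfg hn)) h ho hg hgh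
      (hL.tail hhf hm.symm (by rwa [Set.inter_comm]))
  | @tail f g' g hf' hfg hn ih =>
    intro hnD h hf hg hgh hhf
    have hfg' := hC.tail hf' hfg hn
    have hgh' : A g ∩ A h ⊆ A f := by
      by_contra hc; exact hf.2.2.2 (hC.tail hfg' hf.1.symm hc)
    have hnh : ¬ A g' ∩ A g ⊆ A h := fun hc => hn fun v hv => hgh' ⟨hv.2, hc hv⟩
    by_cases hm : Meet A g' h
    · have ho : Open A (Closure A (SourceAt A D p)) h g' := by
        refine ⟨hm.symm, ?_, ?_, ?_⟩
        · rintro rfl; exact hf.2.2.2 hf'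
        · intro hc
          exact hg.2.2.1 (hC.tail hc hg.1 hnh)
        · intro hc
          exact hg.2.2.2 (hC.head hc hg.1.symm hnh)
      exact ih (fun hc => hnD (hD.tail hc hfg hn)) h hf ho
        (hL.head hgh hm (by rwa [Set.inter_comm])) hhf
    -- If `g'` misses `h`, the rules give `g'` before `g` and then `g` before `h`, although `(g, h)`
    -- is open. The inclusion that is needed comes from `L`, where `g`, `h`, `f` follow each other.
    · have hsub : A g ∩ A f ⊆ A h := by
        by_contra hc; exact hL.asymm hhf (hL.head hgh hf.1.symm hc)
      have hgg : Meet A g' g := by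
        by_contra hc
        exact hn fun v hv => (hc ⟨v, hv⟩).elim
      obtain ⟨w, hw⟩ := hC.meet hf'
      have hng : ¬ A f ∩ A g' ⊆ A g := fun hc => hm ⟨w, hw.2, hsub ⟨hc hw, hw.1⟩⟩
      exact hg.2.2.2 (hC.away (hC.head hfg' hgg hng) hg.1.symm hm)
  | @trans f k g h₁ h₂ hm ih₁ ih₂ =>
    intro hnD h hf hg hgh hhf
    by_cases hkm : Meet A k h
    swap
    · exact hg.2.2.2 (hC.away h₂ hg.1.symm hkm)
    have ho : Open A (Closure A (SourceAt A D p)) h k := by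
      refine ⟨hkm.symm, ?_, ?_, ?_⟩
      · rintro rfl; exact hf.2.2.2 h₁
      · intro hc; exact hg.2.2.1 (hC.trans hc h₂ hg.1)
      · intro hc; exact hf.2.2.2 (hC.trans h₁ hc hf.1.symm)
    -- The direction of `(k, h)` in `L` tells which of the two halves `(f, k)` and `(k, g)` closes a
    -- cyclic triangle with `h`. If that half lies in `D`, it lies in `L`, and transitivity of `L`
    -- passes to the other half or contradicts `L g h`.
    by_cases hd₁ : D f k
    · by_cases hd₂ : D k g
      · exact hnD (hD.trans hd₁ hd₂ hm)
      · exact ih₂ hd₂ h ho hg hgh (hL.trans hhf (hDL _ _ hd₁) ho.1)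
    · rcases hL.total hkm ho.2.1.symm with hl | hl
      · exact ih₁ hd₁ h hf ho hl hhf
      · by_cases hd₂ : D k g
        · exact hL.asymm hgh (hL.trans hl (hDL _ _ hd₂) hg.1)
        · exact ih₂ hd₂ h ho hg hgh hl

/-- Making an element a source of the open part is harmless as long as no contradiction appears. -/
theorem exists_orientation_of_sourceAt [Finite ι] {D L : ι → ι → Prop} {p : ι} (hD : Closed A D)
    (hL : Orientation A L) (hDL : ∀ x y, D x y → L x y)
    (hirr : ∀ x, ¬ Closure A (SourceAt A D p) x x) :
    ∃ L', Orientation A L' ∧ ∀ x y, Closure A (SourceAt A D p) x y → L' x y := by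
  have hC := Closure.closed (A := A) (SourceAt A D p)
  have key : ∀ f g h, Closure A (SourceAt A D p) f g →
      Open A (Closure A (SourceAt A D p)) g h → L g h →
      Open A (Closure A (SourceAt A D p)) h f → ¬ L h f := by
    intro f g h hfg hgh hgh' hhf hhf'
    by_cases hd : D f g
    · exact hL.acyclic f (.tail (.tail (.single (hDL _ _ hd)) hgh') hhf')
    · exact closure_sourceAt_triangle hD hL hDL hfg hd h hhf hgh.symm hgh' hhf'
  have two : ∀ f g h, Closure A (SourceAt A D p) f g → Closure A (SourceAt A D p) g h →
      ¬ Merge A (Closure A (SourceAt A D p)) L h f := by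
    intro f g h h₁ h₂ h₃
    have := hC.trans h₁ h₂ (merge_meet hC h₃).symm
    exact merge_asymm hL hC hirr (.inl this) h₃
  refine ⟨Merge A (Closure A (SourceAt A D p)) L, merge_orientation hL hC hirr ?_,
    fun x y h => .inl h⟩
  -- A cyclic triangle with two closure pairs violates transitivity of the closure, one with a
  -- single closure pair is excluded by `key`, and one with none is a cycle of `L`.
  intro x y z h₁ h₂ h₃
  rcases h₁ with d₁ | ⟨o₁, l₁⟩
  · rcases h₂ with d₂ | ⟨o₂, l₂⟩
    · exact two _ _ _ d₁ d₂ h₃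
    · rcases h₃ with d₃ | ⟨o₃, l₃⟩
      · exact two _ _ _ d₃ d₁ (.inr ⟨o₂, l₂⟩)
      · exact key _ _ _ d₁ o₂ l₂ o₃ l₃
  · rcases h₂ with d₂ | ⟨o₂, l₂⟩
    · rcases h₃ with d₃ | ⟨o₃, l₃⟩
      · exact two _ _ _ d₂ d₃ (.inr ⟨o₁, l₁⟩)
      · exact key _ _ _ d₂ o₃ l₃ o₁ l₁
    · rcases h₃ with d₃ | ⟨o₃, l₃⟩
      · exact key _ _ _ d₃ o₁ l₁ o₂ l₂
      · exact hL.acyclic x (.tail (.tail (.single l₁) l₂) l₃)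

/-- As long as pairs are left open, some element can be made a source of the open part. -/
theorem exists_sourceAt_le [Finite ι] {D L : ι → ι → Prop} (hL : Orientation A L)
    (hDL : ∀ x y, D x y → L x y) {a b : ι} (hab : Open A D a b) :
    ∃ p q, Open A D p q ∧ ∀ x y, Closure A (SourceAt A D p) x y → L x y := by
  -- By minimality, `L` itself directs all open pairs at `p` away from `p`.
  obtain ⟨p, ⟨q, hpq⟩, hp⟩ := hL.exists_minimal {x | ∃ y, Open A D x y} ⟨a, b, hab⟩
  refine ⟨p, q, hpq, fun x y hxy => hxy.le hL.toClosed ?_⟩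
  rintro x y (h | ⟨rfl, h⟩) hm
  · exact hDL _ _ h
  · exact (hL.total hm h.2.1).resolve_right (hp y ⟨x, h.symm⟩)

end Orientation
end DisjointBranches

namespace DisjointBranches

/-! ### Ancestor orders -/

section BranchOrder

variable {ι α : Type*} {A : ι → Set α} {e : ι}

/-- The laws of the ancestor relation of a disjoint branches decomposition with root `e`. -/
structure BranchOrder (A : ι → Set α) (e : ι) (lt : ι → ι → Prop) : Prop where
  irrefl : ∀ x, ¬ lt x x
  trans : ∀ {x y z}, lt x y → lt y z → lt x z
  root : ∀ {x}, x ≠ e → lt e x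
  chain : ∀ {x y z}, lt x z → lt y z → x = y ∨ lt x y ∨ lt y x
  comparable : ∀ {x y}, Meet A x y → x ≠ y → lt x y ∨ lt y x
  convex : ∀ {x y z}, lt x y → lt y z → A x ∩ A z ⊆ A y

/-- Each rule holds because the opposite order violates convexity. For `away`, if `z` were before
`y`, then `x` and `z` would lie on one branch above `y`, and convexity would make them meet. -/
theorem BranchOrder.orientation {lt : ι → ι → Prop} (h : BranchOrder A e lt) :
    Orientation A (fun x y => lt x y ∧ Meet A x y) where
  meet h := h.2
  away := by
    rintro x y z ⟨hxy, hm⟩ hyz hn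
    have hne : y ≠ z := by rintro rfl; exact hn hm
    refine ⟨(h.comparable hyz hne).resolve_right fun hzy => ?_, hyz⟩
    obtain ⟨v, hv⟩ := hm
    obtain ⟨w, hw⟩ := hyz
    rcases h.chain hxy hzy with rfl | hc | hc
    · exact hn ⟨v, hv.1, hv.1⟩
    · exact hn ⟨v, hv.1, h.convex hc hzy hv⟩
    · exact hn ⟨w, h.convex hc hxy ⟨hw.2, hw.1⟩, hw.2⟩
  head := by
    rintro x y z ⟨hxy, hm⟩ hzy hn
    have hne : z ≠ y := by rintro rfl; exact hn Set.inter_subset_right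
    exact ⟨(h.comparable hzy hne).resolve_right fun hc => hn (h.convex hxy hc), hzy⟩
  tail := by
    rintro x y z ⟨hxy, hm⟩ hxz hn
    have hne : x ≠ z := by rintro rfl; exact hn Set.inter_subset_right
    exact ⟨(h.comparable hxz hne).resolve_right fun hc =>
      hn (by rw [Set.inter_comm]; exact h.convex hc hxy), hxz⟩
  trans := fun h₁ h₂ hm => ⟨h.trans h₁.1 h₂.1, hm⟩
  total := fun hm hne => (h.comparable hm hne).imp (fun h => ⟨h, hm⟩) (fun h => ⟨h, hm.symm⟩)
  acyclic := by
    have : ∀ {x y}, Relation.TransGen (fun x y => lt x y ∧ Meet A x y) x y → lt x y := by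
      intro x y hxy
      induction hxy with
      | single h' => exact h'.1
      | tail _ h' ih => exact h.trans ih h'.1
    exact fun x hx => h.irrefl x (this hx)

/-- The relation `D`, with all pairs `(e, x)` added. -/
def WithRoot (D : ι → ι → Prop) (e x y : ι) : Prop := D x y ∨ x = e ∧ y ≠ e

/-- By the rule `away`, two `D`-predecessors of one element meet and are hence comparable. Both
`chain` and `convex` follow by induction on the lower element `z`, by looking at the last step into
`z`. For elements other than `e` this step belongs to `D`, as nothing precedes `e`. -/
theorem branchOrder_of_closed [Finite ι] {D : ι → ι → Prop} (hD : Closed A D)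
    (htot : ∀ x y, Meet A x y → x ≠ y → D x y ∨ D y x)
    (hirr : ∀ x, ¬ Relation.TransGen (WithRoot D e) x x) :
    BranchOrder A e (Relation.TransGen (WithRoot D e)) := by
  have hasymm : ∀ {x y}, Relation.TransGen (WithRoot D e) x y →
      ¬ Relation.TransGen (WithRoot D e) y x := fun h h' => hirr _ (h.trans h')
  have hDT : ∀ {x y}, D x y → Relation.TransGen (WithRoot D e) x y := fun h => .single (.inl h)
  have hroot : ∀ {x}, x ≠ e → Relation.TransGen (WithRoot D e) e x :=
    fun h => .single (.inr ⟨rfl, h⟩)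
  have hlt : ∀ {x}, ¬ Relation.TransGen (WithRoot D e) x e := by
    intro x h
    by_cases hx : x = e
    · subst hx; exact hirr _ h
    · exact hasymm h (hroot hx)
  have hcommon : ∀ {x y z}, D x z → D y z → Meet A x y := by
    intro x y z hx hy
    by_contra hc
    exact hasymm (hDT (hD.away hx (hD.meet hy).symm hc)) (hDT hy)
  have hw : WellFounded (Relation.TransGen (WithRoot D e)) := by
    have : Std.Irrefl (Relation.TransGen (WithRoot D e)) := ⟨hirr⟩
    have : IsTrans ι (Relation.TransGen (WithRoot D e)) :=
      ⟨fun _ _ _ => Relation.TransGen.trans⟩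
    exact Finite.wellFounded_of_trans_of_irrefl _
  refine ⟨hirr, Relation.TransGen.trans, hroot, ?_, ?_, ?_⟩
  · intro x y z
    induction z using hw.induction generalizing x y with
    | _ z ih =>
      intro hx hy
      by_cases hxe : x = e
      · by_cases hye : y = e
        · exact .inl (hxe.trans hye.symm)
        · subst hxe; exact .inr (.inl (hroot hye))
      by_cases hye : y = e
      · subst hye; exact .inr (.inr (hroot hxe))
      obtain ⟨x', hxx', hx'⟩ := Relation.TransGen.tail'_iff.mp hx
      obtain ⟨y', hyy', hy'⟩ := Relation.TransGen.tail'_iff.mp hy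
      have last : ∀ {w w'}, w ≠ e → Relation.ReflTransGen (WithRoot D e) w w' →
          WithRoot D e w' z → D w' z := by
        rintro w w' hwe hww' (h | ⟨rfl, -⟩)
        · exact h
        · rcases Relation.reflTransGen_iff_eq_or_transGen.mp hww' with h | h
          · exact absurd h.symm hwe
          · exact absurd h hlt
      have hx'z := last hxe hxx' hx'
      have hy'z := last hye hyy' hy'
      have fin : ∀ {w}, Relation.ReflTransGen (WithRoot D e) x w →
          Relation.ReflTransGen (WithRoot D e) y w → D w z →
          x = y ∨ Relation.TransGen (WithRoot D e) x y ∨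
            Relation.TransGen (WithRoot D e) y x := by
        intro w h₁ h₂ h₃
        rcases Relation.reflTransGen_iff_eq_or_transGen.mp h₁ with rfl | h₁
        · rcases Relation.reflTransGen_iff_eq_or_transGen.mp h₂ with rfl | h₂
          · exact .inl rfl
          · exact .inr (.inr h₂)
        · rcases Relation.reflTransGen_iff_eq_or_transGen.mp h₂ with rfl | h₂
          · exact .inr (.inl h₁)
          · exact ih w (hDT h₃) h₁ h₂
      by_cases hxy : x' = y'
      · subst hxy; exact fin hxx' hyy' hx'z
      · rcases htot _ _ (hcommon hx'z hy'z) hxy with h | h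
        · exact fin (hxx'.trans (.single (.inl h))) hyy' hy'z
        · exact fin hxx' (hyy'.trans (.single (.inl h))) hx'z
  · exact fun hm hne => (htot _ _ hm hne).imp hDT hDT
  · intro x y z
    induction z using hw.induction generalizing x y with
    | _ z ih =>
      intro hxy hyz v hv
      have hxz : D x z := by
        refine (htot x z ⟨v, hv⟩ ?_).resolve_right fun h => hasymm (hxy.trans hyz) (hDT h)
        rintro rfl; exact hasymm hxy hyz
      obtain ⟨y', hyy', hy'⟩ := Relation.TransGen.tail'_iff.mp hyz
      have hxy' : Relation.TransGen (WithRoot D e) x y' := Relation.TransGen.trans_left hxy hyy'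
      rcases hy' with hy' | ⟨rfl, -⟩
      swap
      · exact absurd hxy' hlt
      have hDxy' : D x y' := by
        refine (htot x y' (hcommon hxz hy') ?_).resolve_right fun h => hasymm hxy' (hDT h)
        rintro rfl; exact hirr _ hxy'
      -- Otherwise the rule `head` puts `z` before `y'`.
      have hv' : v ∈ A y' := by
        by_contra hc
        exact hasymm (hDT hy') (hDT (hD.head hDxy' (hD.meet hy').symm fun h => hc (h hv)))
      rcases Relation.reflTransGen_iff_eq_or_transGen.mp hyy' with rfl | hyy'
      · exact hv'
      · exact ih y' (hDT hy') hxy hyy' ⟨hv.1, hv'⟩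

/-- `y` is a child of `x` in the order `lt`. -/
def Covers (lt : ι → ι → Prop) (x y : ι) : Prop := lt x y ∧ ∀ z, lt x z → ¬ lt z y

/-- The tree of an order: every element is joined to its children. -/
def coverGraph (lt : ι → ι → Prop) : SimpleGraph ι where
  Adj x y := x ≠ y ∧ (Covers lt x y ∨ Covers lt y x)
  symm := ⟨fun _ _ h => ⟨h.1.symm, h.2.symm⟩⟩
  loopless := ⟨fun _ h => h.1 rfl⟩

/-! ### The tree of an ancestor order -/

namespace BranchOrder

variable {lt : ι → ι → Prop} (h : BranchOrder A e lt)
include h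

theorem not_lt_root {x : ι} : ¬ lt x e := by
  intro hx
  by_cases hxe : x = e
  · subst hxe; exact h.irrefl _ hx
  · exact h.irrefl _ (h.trans hx (h.root hxe))

theorem wellFounded [Finite ι] : WellFounded lt := by
  have : Std.Irrefl lt := ⟨h.irrefl⟩
  have : IsTrans ι lt := ⟨fun _ _ _ => h.trans⟩
  exact Finite.wellFounded_of_trans_of_irrefl _

theorem adj_of_covers {x y : ι} (hc : Covers lt x y) : (coverGraph lt).Adj x y :=
  ⟨fun hxy => h.irrefl y (hxy ▸ hc.1), .inl hc⟩

/-- Between `x` and a later element there is a parent of the latter. -/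
theorem exists_parent [Finite ι] {x y : ι} (hxy : lt x y) :
    ∃ p, Covers lt p y ∧ (x = p ∨ lt x p) := by
  have : Std.Irrefl (Function.swap lt) := ⟨h.irrefl⟩
  have : IsTrans ι (Function.swap lt) := ⟨fun _ _ _ h₁ h₂ => h.trans h₂ h₁⟩
  have hw : WellFounded (Function.swap lt) := Finite.wellFounded_of_trans_of_irrefl _
  let s : Set ι := {p | lt p y ∧ (x = p ∨ lt x p)}
  have hs : s.Nonempty := ⟨x, hxy, .inl rfl⟩
  have hm := hw.min_mem s hs
  refine ⟨hw.min s hs, ⟨hm.1, fun z h₁ h₂ => hw.not_lt_min s (x := z) ⟨h₂, .inr ?_⟩ h₁⟩, hm.2⟩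
  rcases hm.2 with h' | h'
  · rwa [h']
  · exact h.trans h' h₁

theorem covers_unique {x y z : ι} (hx : Covers lt x z) (hy : Covers lt y z) : x = y := by
  rcases h.chain hx.1 hy.1 with h' | h' | h'
  · exact h'
  · exact absurd hy.1 (hx.2 _ h')
  · exact absurd hx.1 (hy.2 _ h')

/-- The predecessors of `t` are its parent `q` and, by `chain`, the predecessors of `q`. The support
makes ancestors in the tree rooted in `e` the same as predecessors in the order. -/
theorem exists_path [Finite ι] (t : ι) :
    ∃ p : (coverGraph lt).Walk e t, p.IsPath ∧ ∀ s, s ∈ p.support ↔ s = t ∨ lt s t := by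
  induction t using h.wellFounded.induction with
  | _ t ih =>
    by_cases ht : t = e
    · subst ht
      exact ⟨.nil, by simp, fun s => by simp [h.not_lt_root]⟩
    obtain ⟨q, hq, -⟩ := h.exists_parent (h.root ht)
    obtain ⟨p, hp, hs⟩ := ih q hq.1
    refine ⟨p.concat (h.adj_of_covers hq), hp.concat ?_ _, fun s => ?_⟩
    · rw [hs]
      rintro (rfl | h')
      · exact h.irrefl _ hq.1
      · exact h.irrefl _ (h.trans h' hq.1)
    · rw [SimpleGraph.Walk.support_concat, List.mem_append, hs,
        List.mem_singleton]
      constructor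
      · rintro ((rfl | h') | rfl)
        · exact .inr hq.1
        · exact .inr (h.trans h' hq.1)
        · exact .inl rfl
      · rintro (rfl | h')
        · exact .inr rfl
        · rcases h.chain h' hq.1 with rfl | hc | hc
          · exact .inl (.inl rfl)
          · exact .inl (.inr hc)
          · exact absurd h' (hq.2 _ hc)

theorem coverGraph_isTree [Finite ι] : (coverGraph lt).IsTree := by
  rw [SimpleGraph.isTree_iff_connected_and_card]
  have hr : ∀ t, (coverGraph lt).Reachable e t := fun t => (h.exists_path t).choose.reachable
  have : Nonempty ι := ⟨e⟩
  refine ⟨⟨fun s t => (hr s).symm.trans (hr t)⟩, ?_⟩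
  have hparent : ∀ x : {x // x ≠ e}, ∃ p, Covers lt p x := fun x =>
    let ⟨p, hp, _⟩ := h.exists_parent (h.root x.2); ⟨p, hp⟩
  choose par hpar using hparent
  -- Each edge joins a unique non-root element to its parent, so there is one edge fewer than there
  -- are vertices.
  let f : {x // x ≠ e} → (coverGraph lt).edgeSet :=
    fun x => ⟨s(par x, x), h.adj_of_covers (hpar x)⟩
  have hf : Function.Bijective f := by
    constructor
    · intro x y hxy
      have : s(par x, (x : ι)) = s(par y, (y : ι)) := congrArg Subtype.val hxy
      rcases Sym2.eq_iff.mp this with ⟨_, h'⟩ | ⟨h₁, h₂⟩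
      · exact Subtype.ext h'
      · have hx := (hpar x).1
        have hy := (hpar y).1
        rw [h₁] at hx
        rw [← h₂] at hy
        exact absurd (h.trans hx hy) (h.irrefl _)
    · rintro ⟨z, hz⟩
      induction z with
      | _ a b =>
        rcases (show (coverGraph lt).Adj a b from hz).2 with hc | hc
        · have hb : b ≠ e := by rintro rfl; exact h.not_lt_root hc.1
          refine ⟨⟨b, hb⟩, Subtype.ext ?_⟩
          simp [f, h.covers_unique (hpar ⟨b, hb⟩) hc]
        · have ha : a ≠ e := by rintro rfl; exact h.not_lt_root hc.1
          refine ⟨⟨a, ha⟩, Subtype.ext ?_⟩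
          simp [f, h.covers_unique (hpar ⟨a, ha⟩) hc, Sym2.eq_swap]
  rw [← Nat.card_eq_of_bijective f hf]
  have := Set.ncard_add_ncard_compl ({e} : Set ι)
  rw [Set.ncard_singleton] at this
  rw [← this, add_comm]
  rfl

/-- By convexity, the parent of a node containing `v` contains `v` as well, as long as some ancestor
does; so the path up to that ancestor stays inside. -/
theorem preconnected_induce [Finite ι] (v : α) :
    ((coverGraph lt).induce {t | v ∈ A t}).Preconnected := by
  have down : ∀ t : ι, ∀ s (ht : v ∈ A t) (hs : v ∈ A s), lt s t →
      ((coverGraph lt).induce {t | v ∈ A t}).Reachable ⟨s, hs⟩ ⟨t, ht⟩ := by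
    intro t
    induction t using h.wellFounded.induction with
    | _ t ih =>
      intro s ht hs hst
      obtain ⟨p, hp, hsp⟩ := h.exists_parent hst
      have hpv : v ∈ A p := by
        rcases hsp with rfl | hsp
        · exact hs
        · exact h.convex hsp hp.1 ⟨hs, ht⟩
      have hadj : ((coverGraph lt).induce {t | v ∈ A t}).Adj ⟨p, hpv⟩ ⟨t, ht⟩ :=
        h.adj_of_covers hp
      rcases hsp with rfl | hsp
      · exact hadj.reachable
      · exact (ih p hp.1 s hpv hs hsp).trans hadj.reachable
  rintro ⟨s, hs⟩ ⟨t, ht⟩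
  by_cases hst : s = t
  · subst hst; exact .refl _
  · rcases h.comparable ⟨v, hs, ht⟩ hst with h' | h'
    · exact down t s ht hs h'
    · exact (down s t hs ht h').symm

end BranchOrder

end BranchOrder

/-! ### Decompositions and ancestor orders -/

section Decomposition

variable {α : Type} {H : Hypergraph α}

/-- The decomposition whose ancestor order is a given order. -/
def BranchOrder.decomposition [Finite H.edgeSet] {lt : H.edgeSet → H.edgeSet → Prop}
    {e : H.edgeSet} (h : BranchOrder (fun x : H.edgeSet => (x : Set α)) e lt) :
    Decomposition H where
  Node := H.edgeSet
  tree := coverGraph lt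
  isTree := h.coverGraph_isTree
  label := Equiv.refl _
  connectedness v _ := h.preconnected_induce v
  root := e
  disjoint_branches := by
    intro s t hst
    by_contra hne
    have anc : ∀ {s t : H.edgeSet}, s = t ∨ lt s t →
        ∃ p : (coverGraph lt).Walk e t, p.IsPath ∧ s ∈ p.support := fun {s t} hs =>
      let ⟨p, hp, hp'⟩ := h.exists_path t; ⟨p, hp, (hp' s).mpr hs⟩
    by_cases hs : s = t
    · exact hst.1 (anc (.inl hs))
    · rcases h.comparable (Set.nonempty_iff_ne_empty.mpr hne) hs with h' | h'
      · exact hst.1 (anc (.inr h'))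
      · exact hst.2 (anc (.inr h'))

/-- The ancestor relation of a rooted tree, on the labels. -/
def Decomposition.Lt (D : Decomposition H) (x y : H.edgeSet) : Prop :=
  x ≠ y ∧ D.IsAncestor D.root (D.label.symm x) (D.label.symm y)

/-- The order laws come from the uniqueness of paths in a tree, comparability from disjointness of
branches, and convexity from the connectedness condition. -/
theorem Decomposition.branchOrder (D : Decomposition H) :
    BranchOrder (fun x : H.edgeSet => (x : Set α)) (D.label D.root) D.Lt := by
  classical
  have huniq : ∀ {s t : D.Node} (p q : D.tree.Walk s t), p.IsPath → q.IsPath → p = q := by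
    intro s t p q hp hq
    have := D.isTree.isAcyclic.subsingleton_path s t
    exact congrArg Subtype.val (Subsingleton.elim (⟨p, hp⟩ : D.tree.Path s t) ⟨q, hq⟩)
  have hex : ∀ s t : D.Node, ∃ p : D.tree.Walk s t, p.IsPath := fun s t =>
    let ⟨p⟩ := D.isTree.connected.preconnected s t
    ⟨p.bypass, p.bypass_isPath⟩
  have htrans : ∀ {x y z : D.Node}, D.IsAncestor D.root x y → D.IsAncestor D.root y z →
      D.IsAncestor D.root x z := by
    rintro x y z ⟨p, hp, hx⟩ ⟨q, hq, hy⟩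
    refine ⟨q, hq, ?_⟩
    rw [huniq p (q.takeUntil y hy) hp (hq.takeUntil hy)] at hx
    exact q.support_takeUntil_subset_support hy hx
  have hanti : ∀ {x y : D.Node}, D.IsAncestor D.root x y → D.IsAncestor D.root y x → x = y := by
    rintro x y ⟨p, hp, hx⟩ ⟨q, hq, hy⟩
    by_contra hne
    have h₁ := huniq q (p.takeUntil x hx) hq (hp.takeUntil hx)
    have h₂ := huniq p (q.takeUntil y hy) hp (hq.takeUntil hy)
    have l₁ := p.length_takeUntil_lt_length hx hne
    have l₂ := q.length_takeUntil_lt_length hy (Ne.symm hne)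
    rw [← h₁] at l₁
    rw [← h₂] at l₂
    omega
  have hchain : ∀ {x y z : D.Node}, D.IsAncestor D.root x z → D.IsAncestor D.root y z →
      D.IsAncestor D.root x y ∨ D.IsAncestor D.root y x := by
    rintro x y z ⟨p, hp, hx⟩ ⟨q, hq, hy⟩
    obtain rfl := huniq p q hp hq
    by_cases h : x ∈ (p.takeUntil y hy).support
    · exact .inl ⟨_, hp.takeUntil hy, h⟩
    · have hd : x ∈ (p.dropUntil y hy).support := by
        rw [← p.take_spec hy, SimpleGraph.Walk.mem_support_append_iff] at hx
        exact hx.resolve_left h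
      refine .inr ⟨(p.takeUntil y hy).append ((p.dropUntil y hy).takeUntil x hd), ?_, ?_⟩
      · refine SimpleGraph.Walk.IsPath.of_append_left (q := (p.dropUntil y hy).dropUntil x hd) ?_
        rwa [← SimpleGraph.Walk.append_assoc, SimpleGraph.Walk.take_spec,
          SimpleGraph.Walk.take_spec]
      · exact (SimpleGraph.Walk.mem_support_append_iff _ _).mpr (.inl (SimpleGraph.Walk.end_mem_support _))
  have hconv : ∀ {x y z : D.Node}, D.IsAncestor D.root x y → D.IsAncestor D.root y z →
      ∀ v, v ∈ (D.label x : Set α) → v ∈ (D.label z : Set α) → v ∈ (D.label y : Set α) := by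
    rintro x y z ⟨p, hp, hx⟩ ⟨q, hq, hy⟩ v hvx hvz
    obtain rfl := huniq p (q.takeUntil y hy) hp (hq.takeUntil hy)
    -- The only path from `x` to `z` passes through `y`, and shortening a walk among the nodes
    -- containing `v` must produce this path.
    let r : D.tree.Walk x z := ((q.takeUntil y hy).dropUntil x hx).append (q.dropUntil y hy)
    have hr : r.IsPath := by
      refine SimpleGraph.Walk.IsPath.of_append_right (p := (q.takeUntil y hy).takeUntil x hx) ?_
      rwa [SimpleGraph.Walk.append_assoc, SimpleGraph.Walk.take_spec, SimpleGraph.Walk.take_spec]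
    have hyr : y ∈ r.support :=
      (SimpleGraph.Walk.mem_support_append_iff _ _).mpr (.inl (SimpleGraph.Walk.end_mem_support _))
    obtain ⟨w⟩ := D.connectedness v (H.mem_vertexSet_of_mem_edgeSet (D.label x).2 hvx)
      ⟨x, hvx⟩ ⟨z, hvz⟩
    let w' : D.tree.Walk x z := w.map (SimpleGraph.Embedding.induce _).toHom
    rw [huniq r w'.bypass hr w'.bypass_isPath] at hyr
    have hyw := w'.support_bypass_subset_support hyr
    rw [show w'.support = _ from SimpleGraph.Walk.support_map _ _, List.mem_map] at hyw
    obtain ⟨u, -, rfl⟩ := hyw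
    exact u.2
  have hne : ∀ {x y : H.edgeSet}, x ≠ y → D.label.symm x ≠ D.label.symm y := fun h h' =>
    h (D.label.symm.injective h')
  refine ⟨fun x h => h.1 rfl, ?_, ?_, ?_, ?_, ?_⟩
  · rintro x y z ⟨h₁, h₂⟩ ⟨h₃, h₄⟩
    refine ⟨?_, htrans h₂ h₄⟩
    rintro rfl
    exact hne h₁ (hanti h₂ h₄)
  · intro x hx
    obtain ⟨p, hp⟩ := hex D.root (D.label.symm x)
    exact ⟨hx.symm, p, hp, by simp⟩
  · rintro x y z ⟨-, h₁⟩ ⟨-, h₂⟩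
    by_cases hxy : x = y
    · exact .inl hxy
    · exact .inr ((hchain h₁ h₂).imp (fun h => ⟨hxy, h⟩) (fun h => ⟨Ne.symm hxy, h⟩))
  · intro x y hm hxy
    by_contra hc
    have := D.disjoint_branches (D.label.symm x) (D.label.symm y)
      ⟨fun h => hc (.inl ⟨hxy, h⟩), fun h => hc (.inr ⟨Ne.symm hxy, h⟩)⟩
    simp only [Equiv.apply_symm_apply] at this
    exact hm.ne_empty this
  · rintro x y z ⟨-, h₁⟩ ⟨-, h₂⟩ v hv
    simpa using hconv h₁ h₂ v (by simpa using hv.1) (by simpa using hv.2)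

end Decomposition
end DisjointBranches

namespace DisjointBranches

/-! ### Polynomial-time functions -/

theorem eval_mono (q : Polynomial ℕ) {m n : ℕ} (h : m ≤ n) : q.eval m ≤ q.eval n := by
  rw [Polynomial.eval_eq_sum_range, Polynomial.eval_eq_sum_range]
  gcongr

namespace Dat

/-- The list that is represented by a tree. -/
def toList : Dat → List Dat
  | nil => []
  | cons a b => a :: b.toList

@[simp] theorem toList_ofList (l : List Dat) : (ofList l).toList = l := by
  induction l with
  | nil => rfl
  | cons a l ih => simp [ofList, toList, ih]

@[simp] theorem ofList_toList (d : Dat) : ofList d.toList = d := by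
  induction d with
  | nil => rfl
  | cons a b _ ih => simp [ofList, toList, ih]

theorem length_toList_lt (d : Dat) : d.toList.length < d.size := by
  induction d with
  | nil => simp [toList, size]
  | cons a b _ ih => simp only [toList, size, List.length_cons]; omega

theorem size_le_of_mem {d a : Dat} (h : a ∈ d.toList) : a.size ≤ d.size := by
  induction d with
  | nil => simp [toList] at h
  | cons b c _ ih =>
    simp only [toList, List.mem_cons] at h
    simp only [size]
    rcases h with rfl | h
    · omega
    · have := ih h; omega

theorem size_ofList_le_of_sublist {l m : List Dat} (h : l.Sublist m) :
    (ofList l).size ≤ (ofList m).size := by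
  induction h with
  | slnil => exact le_rfl
  | cons a _ ih => simp only [ofList, size]; omega
  | cons_cons a _ ih => simp only [ofList, size]; omega

end Dat

/-- The function `f` is computed by a program in polynomial time. -/
def PolyTime (f : Dat → Dat) : Prop :=
  ∃ (p : Prog) (q : Polynomial ℕ), ∀ x, ∃ t, p.Run x (f x) t ∧ t ≤ q.eval x.size

/-- The test `f` is computed by a program in polynomial time. -/
def PolyTimeTest (f : Dat → Bool) : Prop := PolyTime fun x => .ofBool (f x)

namespace PolyTime

variable {f g : Dat → Dat}

theorem size_le (hf : PolyTime f) : ∃ q : Polynomial ℕ, ∀ x, (f x).size ≤ q.eval x.size := by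
  obtain ⟨p, q, h⟩ := hf
  refine ⟨q, fun x => ?_⟩
  obtain ⟨t, ht, hq⟩ := h x
  exact ht.size_le.trans hq

theorem congr (hf : PolyTime f) (h : ∀ x, f x = g x) : PolyTime g := funext h ▸ hf

theorem id : PolyTime fun x => x := ⟨.id, .X, fun x => ⟨_, .id x, by simp⟩⟩

theorem nil : PolyTime fun _ => .nil := ⟨.nil, .X, fun x => ⟨_, .nil x, by simp⟩⟩

theorem comp (hg : PolyTime g) (hf : PolyTime f) : PolyTime fun x => g (f x) := by
  obtain ⟨p, q, hp⟩ := hf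
  obtain ⟨p', q', hp'⟩ := hg
  refine ⟨.seq p p', q + q'.comp q + .X, fun x => ?_⟩
  obtain ⟨t, ht, hq⟩ := hp x
  obtain ⟨t', ht', hq'⟩ := hp' (f x)
  refine ⟨_, .seq ht ht', ?_⟩
  have := eval_mono q' (ht.size_le.trans hq)
  simp only [Polynomial.eval_add, Polynomial.eval_comp, Polynomial.eval_X]
  omega

theorem head (hf : PolyTime f) : PolyTime fun x => (f x).head :=
  comp (g := Dat.head) ⟨.hd, .X, fun x => ⟨_, .hd x, by simp⟩⟩ hf

theorem tail (hf : PolyTime f) : PolyTime fun x => (f x).tail :=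
  comp (g := Dat.tail) ⟨.tl, .X, fun x => ⟨_, .tl x, by simp⟩⟩ hf

theorem cons (hf : PolyTime f) (hg : PolyTime g) : PolyTime fun x => .cons (f x) (g x) := by
  obtain ⟨p, q, hp⟩ := hf
  obtain ⟨p', q', hp'⟩ := hg
  -- The factor 2 pays for the size of the resulting pair, which is at most the two running times
  -- plus one.
  refine ⟨.pair p p', 2 * (q + q') + .X + 1, fun x => ?_⟩
  obtain ⟨t, ht, hq⟩ := hp x
  obtain ⟨t', ht', hq'⟩ := hp' x
  refine ⟨_, .pair ht ht', ?_⟩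
  have := ht.size_le
  have := ht'.size_le
  simp only [Polynomial.eval_add, Polynomial.eval_mul, Polynomial.eval_ofNat, Polynomial.eval_one,
    Polynomial.eval_X, Dat.size]
  omega

theorem const (d : Dat) : PolyTime fun _ => d := by
  induction d with
  | nil => exact nil
  | cons a b iha ihb => exact cons iha ihb

theorem ite {c : Dat → Bool} (hc : PolyTimeTest c) (hf : PolyTime f) (hg : PolyTime g) :
    PolyTime fun x => bif c x then f x else g x := by
  obtain ⟨pc, qc, hpc⟩ := hc
  obtain ⟨p, q, hp⟩ := hf
  obtain ⟨p', q', hp'⟩ := hg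
  refine ⟨.cond pc p p', qc + q + q' + .X, fun x => ?_⟩
  obtain ⟨tc, htc, hqc⟩ := hpc x
  obtain ⟨t, ht, hq⟩ := hp x
  obtain ⟨t', ht', hq'⟩ := hp' x
  simp only [Polynomial.eval_add, Polynomial.eval_X]
  cases h : c x
  · simp only [h] at htc
    exact ⟨_, .cond_false htc ht', by omega⟩
  · simp only [h] at htc
    exact ⟨_, .cond_true htc (by simp [Dat.ofBool]) ht, by omega⟩

theorem foldl_size_le {F : Dat → Dat → Dat} {l : List Dat} {b : ℕ}
    (h : ∀ s, ∀ a ∈ l, (F s a).size ≤ s.size + b) (s : Dat) :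
    (l.foldl F s).size ≤ s.size + l.length * b := by
  induction l generalizing s with
  | nil => simp
  | cons a l ih =>
    have h₁ := h s a (by simp)
    have h₂ := ih (fun s a ha => h s a (by simp [ha])) (F s a)
    simp only [List.foldl_cons, List.length_cons, add_mul, one_mul]
    omega

/-- Iteration over a list is possible in polynomial time when every step increases the size of the
current value only by an amount that does not depend on this value. -/
theorem foldl {F : Dat → Dat → Dat → Dat} {l i : Dat → Dat}
    (hF : PolyTime fun y => F y.head y.tail.head y.tail.tail)
    (hB : ∃ B : Polynomial ℕ, ∀ x s a, (F x s a).size ≤ s.size + B.eval (x.size + a.size))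
    (hl : PolyTime l) (hi : PolyTime i) :
    PolyTime fun x => (l x).toList.foldl (F x) (i x) := by
  obtain ⟨B, hB⟩ := hB
  obtain ⟨pt, qt, ht⟩ : PolyTime fun z => z.tail.tail := id.tail.tail
  have hbody : PolyTime fun z => .cons z.head
      (.cons (F z.head z.tail.head z.tail.tail.head) z.tail.tail.tail) := by
    refine cons id.head (cons ?_ id.tail.tail.tail)
    exact hF.comp (f := fun z => .cons z.head (.cons z.tail.head z.tail.tail.head))
      (cons id.head (cons id.tail.head id.tail.tail.head))
  obtain ⟨pb, qb, hb⟩ := hbody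
  -- `Q` bounds the cost of one round on a tree of size at most `M`. The loop carries the context
  -- `c`, the current value `s` and the remaining list `d`; the bound on `M` leaves room for the
  -- growth in all remaining rounds.
  let Q : Polynomial ℕ := qt + qb + .X
  have hloop : ∀ (c : Dat) (K M : ℕ) (d s : Dat), (∀ a ∈ d.toList, a.size ≤ K) →
      c.size + s.size + d.size + 2 + d.toList.length * B.eval (c.size + K) ≤ M →
      ∃ t, (Prog.loop pt pb).Run (.cons c (.cons s d))
        (.cons c (.cons (d.toList.foldl (F c) s) .nil)) t ∧
        t ≤ (d.toList.length + 1) * Q.eval M := by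
    intro c K M d
    induction d with
    | nil =>
      intro s _ hM
      obtain ⟨t, h₁, h₂⟩ := ht (.cons c (.cons s .nil))
      refine ⟨_, Prog.Run.loop_stop h₁, ?_⟩
      have hsz : (Dat.cons c (.cons s .nil)).size ≤ M := by
        simp only [Dat.size] at hM ⊢; omega
      have := eval_mono qt hsz
      simp only [Dat.toList, List.length_nil, zero_add, one_mul, Q, Polynomial.eval_add,
        Polynomial.eval_X]
      omega
    | cons a d _ ih =>
      intro s hK hM
      have ha : a.size ≤ K := hK a (by simp [Dat.toList])
      have hB' := (hB c s a).trans (Nat.add_le_add_left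
        (eval_mono B (Nat.add_le_add_left ha c.size)) s.size)
      simp only [Dat.toList, List.length_cons, add_mul, one_mul, Dat.size] at hM
      obtain ⟨t, h₁, h₂⟩ := ht (.cons c (.cons s (.cons a d)))
      obtain ⟨t', h₁', h₂'⟩ := hb (.cons c (.cons s (.cons a d)))
      obtain ⟨u, h₃, h₄⟩ := ih (F c s a) (fun b hb => hK b (by simp [Dat.toList, hb]))
        (by omega)
      refine ⟨_, .loop_step h₁ (by simp [Dat.tail]) h₁' h₃, ?_⟩
      have hsz : (Dat.cons c (.cons s (.cons a d))).size ≤ M := by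
        simp only [Dat.size]; omega
      have e₁ := eval_mono qt hsz
      have e₂ := eval_mono qb hsz
      have e₃ : Q.eval M = qt.eval M + qb.eval M + M := by simp [Q]
      simp only [Dat.toList, List.length_cons]
      rw [add_mul (d.toList.length + 1) 1, one_mul]
      omega
  have hpre : PolyTime fun x => .cons x (.cons (i x) (l x)) := cons id (cons hi hl)
  have hmid : PolyTime fun x => .cons x (.cons ((l x).toList.foldl (F x) (i x)) .nil) := by
    obtain ⟨pp, qp, hp⟩ := hpre
    let M : Polynomial ℕ := qp + qp * B.comp qp
    refine ⟨.seq pp (.loop pt pb), qp + qp * Q.comp M + .X, fun x => ?_⟩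
    obtain ⟨t, h₁, h₂⟩ := hp x
    have hsz := h₁.size_le.trans h₂
    simp only [Dat.size] at hsz
    have hlen := (l x).length_toList_lt
    have hM : x.size + (i x).size + (l x).size + 2 +
        (l x).toList.length * B.eval (x.size + (l x).size) ≤ M.eval x.size := by
      have h₃ : (l x).toList.length * B.eval (x.size + (l x).size) ≤
          qp.eval x.size * B.eval (qp.eval x.size) :=
        Nat.mul_le_mul (by omega) (eval_mono B (by omega))
      simp only [M, Polynomial.eval_add, Polynomial.eval_mul, Polynomial.eval_comp]
      omega
    obtain ⟨u, h₃, h₄⟩ := hloop x (l x).size _ (l x) (i x) (fun a ha => Dat.size_le_of_mem ha) hM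
    refine ⟨_, .seq h₁ h₃, ?_⟩
    have h₅ : ((l x).toList.length + 1) * Q.eval (M.eval x.size) ≤
        qp.eval x.size * Q.eval (M.eval x.size) := Nat.mul_le_mul_right _ (by omega)
    simp only [Polynomial.eval_add, Polynomial.eval_mul, Polynomial.eval_comp, Polynomial.eval_X]
    omega
  exact hmid.tail.head

theorem reverse (hf : PolyTime f) : PolyTime fun x => .ofList (f x).toList.reverse := by
  have h : PolyTime fun x => (f x).toList.foldl (fun s a => .cons a s) .nil := by
    refine foldl (F := fun _ s a => .cons a s) (cons id.tail.tail id.tail.head) ⟨.X + 1, ?_⟩ hf nil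
    intro x s a
    simp only [Dat.size, Polynomial.eval_add, Polynomial.eval_X, Polynomial.eval_one]
    omega
  have key : ∀ (m : List Dat) (s : Dat),
      m.foldl (fun s a => .cons a s) s = Dat.ofList (m.reverse ++ s.toList) := by
    intro m
    induction m with
    | nil => simp
    | cons a m ih => intro s; simp [ih, Dat.toList]
  simpa [key, Dat.toList] using h

theorem filter {P : Dat → Dat → Bool} (hP : PolyTimeTest fun y => P y.head y.tail)
    (hf : PolyTime f) : PolyTime fun x => .ofList ((f x).toList.filter (P x)) := by
  have h : PolyTime fun x =>
      (f x).toList.foldl (fun s a => bif P x a then .cons a s else s) .nil := by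
    refine foldl (F := fun x s a => bif P x a then .cons a s else s) ?_ ⟨.X + 1, ?_⟩ hf nil
    · refine ite ?_ (cons id.tail.tail id.tail.head) id.tail.head
      exact hP.comp (f := fun y => .cons y.head y.tail.tail) (cons id.head id.tail.tail)
    · intro x s a
      simp only [Polynomial.eval_add, Polynomial.eval_X, Polynomial.eval_one]
      cases P x a
      · simp only [cond_false]; omega
      · simp only [cond_true, Dat.size]; omega
  have key : ∀ (x : Dat) (m : List Dat) (s : Dat),
      m.foldl (fun s a => bif P x a then .cons a s else s) s =
        Dat.ofList ((m.filter (P x)).reverse ++ s.toList) := by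
    intro x m
    induction m with
    | nil => simp
    | cons a m ih => intro s; cases hP : P x a <;> simp [ih, Dat.toList, hP]
  simpa [key, Dat.toList] using h.reverse

end PolyTime

namespace PolyTimeTest

variable {f g : Dat → Bool}

theorem congr (hf : PolyTimeTest f) (h : ∀ x, f x = g x) : PolyTimeTest g := funext h ▸ hf

theorem not (hf : PolyTimeTest f) : PolyTimeTest fun x => !f x := by
  have := PolyTime.ite hf (.const (.ofBool false)) (.const (.ofBool true))
  refine PolyTime.congr this fun x => ?_
  cases h : f x <;> simp [h]

theorem and (hf : PolyTimeTest f) (hg : PolyTimeTest g) : PolyTimeTest fun x => f x && g x := by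
  have := PolyTime.ite hf hg (.const (.ofBool false))
  refine PolyTime.congr this fun x => ?_
  cases h : f x <;> simp [h]

theorem or (hf : PolyTimeTest f) (hg : PolyTimeTest g) : PolyTimeTest fun x => f x || g x := by
  have := PolyTime.ite hf (.const (.ofBool true)) hg
  refine PolyTime.congr this fun x => ?_
  cases h : f x <;> simp [h]

theorem eq {f g : Dat → Dat} (hf : PolyTime f) (hg : PolyTime g) :
    PolyTimeTest fun x => f x == g x := by
  -- The tree `nil` is excluded since its two components are both `nil` by default, while `Prog.eq`
  -- answers false on it.
  let h : Dat → Dat := fun z => .ofBool (decide (z.head = z.tail ∧ z ≠ .nil))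
  have hh : PolyTime h := by
    refine ⟨.eq, .X, fun z => ?_⟩
    cases z with
    | nil => exact ⟨_, .eq_false _ (by simp), by simp⟩
    | cons a b =>
      by_cases hab : a = b
      · subst hab
        exact ⟨_, by simpa [h, Dat.head, Dat.tail] using Prog.Run.eq_true a, by simp⟩
      · refine ⟨_, ?_, (Polynomial.eval_X (R := ℕ)).ge⟩
        have := Prog.Run.eq_false (.cons a b) (by rintro c ⟨⟩; exact hab rfl)
        simpa [h, Dat.head, Dat.tail, hab] using this
  exact (hh.comp (hf.cons hg)).congr fun x => by
    by_cases hfg : f x = g x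
    · simp [h, Dat.head, Dat.tail, hfg]
    · simp [h, Dat.head, Dat.tail, hfg, beq_eq_false_iff_ne.mpr hfg]

theorem any {P : Dat → Dat → Bool} {l : Dat → Dat} (hP : PolyTimeTest fun y => P y.head y.tail)
    (hl : PolyTime l) : PolyTimeTest fun x => (l x).toList.any (P x) := by
  have h := (eq (PolyTime.filter hP hl) .nil).not
  refine congr h fun x => ?_
  induction (l x).toList with
  | nil => rfl
  | cons a m ih => cases hP : P x a <;> simp_all [Dat.ofList]

theorem all {P : Dat → Dat → Bool} {l : Dat → Dat} (hP : PolyTimeTest fun y => P y.head y.tail)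
    (hl : PolyTime l) : PolyTimeTest fun x => (l x).toList.all (P x) := by
  have h := (any (P := fun x a => !P x a) hP.not hl).not
  refine congr h fun x => ?_
  rw [List.not_any_eq_all_not]
  simp

end PolyTimeTest
end DisjointBranches

namespace DisjointBranches

/-! ### The algorithm -/

namespace Algo

/-- Is `a` an entry of `l`? -/
def mem (a l : Dat) : Bool := l.toList.any fun b => a == b

/-- Do `a` and `b` have a common entry? -/
def meets (a b : Dat) : Bool := a.toList.any fun v => mem v b

/-- Is every common entry of `x` and `z` an entry of `y`? -/
def interSub (x z y : Dat) : Bool := x.toList.all fun v => !mem v z || mem v y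

/-- Does the list of pairs `D` relate `a` to `b`? -/
def rel (D a b : Dat) : Bool := mem (.cons a b) D

/-- All pairs of entries of `E`. -/
def pairs (E : Dat) : Dat :=
  E.toList.foldl (fun s a => E.toList.foldl (fun s b => .cons (.cons a b) s) s) .nil

/-- The pairs in `W` that satisfy `P`. -/
def select (W : Dat) (P : Dat → Dat → Bool) : Dat :=
  .ofList (W.toList.filter fun w => P w.head w.tail)

/-- Apply `F` as often as `W` has entries. -/
def repeated (W : Dat) (F : Dat → Dat) (D : Dat) : Dat := W.toList.foldl (fun s _ => F s) D

/-- Does the pair `(a, b)` follow from `D` by one of the closure rules? -/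
def derives (E D a b : Dat) : Bool :=
  rel D a b || (meets a b && E.toList.any fun z =>
    (rel D z a && !meets z b) || ((rel D z b && !interSub z a b) ||
      ((rel D a z && !interSub z b a) || (rel D a z && rel D z b))))

/-- The closure of `D`. -/
def close (E W D : Dat) : Dat := repeated W (fun D => select W (derives E D)) D

/-- The closure of `D` with `p` as a source of its open part. -/
def extend (E W D p : Dat) : Dat :=
  close E W (select W fun a b =>
    rel D a b || (a == p && (meets a b && (!(a == b) && !rel D b a))))

/-- Is no entry of `E` related to itself? -/
def irrefl (E D : Dat) : Bool := E.toList.all fun a => !rel D a a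

/-- Make `p` a source unless this leads to a contradiction. -/
def attempt (E W D p : Dat) : Dat :=
  bif irrefl E (extend E W D p) then extend E W D p else D

/-- Try all entries of `E` as sources. -/
def sweep (E W D : Dat) : Dat := E.toList.foldl (fun D p => attempt E W D p) D

/-- The orientation that the algorithm computes. -/
def orient (E W e : Dat) : Dat := repeated W (sweep E W) (extend E W .nil e)

/-- The transitive closure of `D` and the pairs `(e, x)`. -/
def order (E W e D : Dat) : Dat :=
  repeated W (fun T => select W fun a b => rel T a b || E.toList.any fun z => rel T a z && rel T z b)
    (select W fun a b => rel D a b || (a == e && !(b == e)))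

/-- Does `D` compare any two entries of `E` that intersect? -/
def total (E D : Dat) : Bool :=
  E.toList.all fun a => E.toList.all fun b => !meets a b || (a == b || (rel D a b || rel D b a))

/-- The covering pairs of `T`. -/
def covering (E W T : Dat) : Dat :=
  select W fun a b => rel T a b && E.toList.all fun z => !(rel T a z && rel T z b)

/-- The entry of `E` with the same entries as `r`. -/
def findRoot (E r : Dat) : Dat :=
  Dat.head (.ofList (E.toList.filter fun f =>
    (f.toList.all fun v => mem v r) && r.toList.all fun v => mem v f))

/-- The result of the algorithm, from the orientation and the order that were computed. -/
def output (E W e D T : Dat) : Dat :=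
  bif irrefl E T && total E D then .cons e (.cons E (covering E W T)) else .nil

/-- The algorithm, for a list of edges and a root. -/
def compute (E W e : Dat) : Dat := output E W e (orient E W e) (order E W e (orient E W e))

/-- The algorithm. -/
def computeDB (x : Dat) : Dat :=
  compute x.head.tail (pairs x.head.tail) (findRoot x.head.tail x.tail)

/-! ### The steps of the algorithm run in polynomial time -/

section PolyTime

open PolyTime PolyTimeTest

variable {a b c d D E W T e p f : Dat → Dat}

theorem polyTime_mem (ha : PolyTime a) (hl : PolyTime f) :
    PolyTimeTest fun x => mem (a x) (f x) :=
  any (P := fun x b => a x == b) (eq (ha.comp id.head) id.tail) hl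

theorem polyTime_meets (ha : PolyTime a) (hb : PolyTime b) :
    PolyTimeTest fun x => meets (a x) (b x) :=
  any (P := fun x v => mem v (b x)) (polyTime_mem id.tail (hb.comp id.head)) ha

theorem polyTime_interSub (ha : PolyTime a) (hb : PolyTime b) (hc : PolyTime c) :
    PolyTimeTest fun x => interSub (a x) (b x) (c x) :=
  all (P := fun x v => !mem v (b x) || mem v (c x))
    ((polyTime_mem id.tail (hb.comp id.head)).not.or (polyTime_mem id.tail (hc.comp id.head))) ha

theorem polyTime_rel (hD : PolyTime D) (ha : PolyTime a) (hb : PolyTime b) :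
    PolyTimeTest fun x => rel (D x) (a x) (b x) :=
  polyTime_mem (ha.cons hb) hD

theorem pairs_inner_size (E a s : Dat) :
    (E.toList.foldl (fun s b => .cons (.cons a b) s) s).size ≤
      s.size + E.size * (a.size + E.size + 2) := by
  refine (foldl_size_le (F := fun s b => .cons (.cons a b) s) (b := a.size + E.size + 2)
    (fun s b hb => ?_) s).trans ?_
  · have := Dat.size_le_of_mem hb
    simp only [Dat.size]
    omega
  · have := Nat.mul_le_mul_right (a.size + E.size + 2) E.length_toList_lt.le
    omega

theorem polyTime_pairs (hE : PolyTime E) : PolyTime fun x => pairs (E x) := by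
  refine foldl (F := fun x s a => (E x).toList.foldl (fun s b => .cons (.cons a b) s) s) ?_ ?_ hE nil
  · refine foldl (F := fun y s b => .cons (.cons y.tail.tail b) s) ?_ ⟨.X + 2, ?_⟩
      (hE.comp id.head) id.tail.head
    · exact (id.head.tail.tail.cons id.tail.tail).cons id.tail.head
    · intro y s b
      have h₁ : y.tail.tail.size ≤ y.size := by
        rcases y with - | ⟨-, - | ⟨-, -⟩⟩ <;> simp only [Dat.tail, Dat.size] <;> omega
      simp only [Dat.size, Polynomial.eval_add, Polynomial.eval_X, Polynomial.eval_ofNat]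
      omega
  · obtain ⟨q, hq⟩ := hE.size_le
    refine ⟨q * (.X + q + 2), fun x s a => (pairs_inner_size _ _ _).trans ?_⟩
    simp only [Polynomial.eval_add, Polynomial.eval_X, Polynomial.eval_ofNat, Polynomial.eval_mul]
    have h₁ : (E x).size ≤ q.eval (x.size + a.size) := (hq x).trans (eval_mono q (by omega))
    gcongr
    omega

theorem polyTime_select {P : Dat → Dat → Dat → Bool}
    (hP : PolyTimeTest fun y => P y.head y.tail.head y.tail.tail) (hW : PolyTime W) :
    PolyTime fun x => select (W x) (P x) :=
  filter (P := fun x w => P x w.head w.tail) hP hW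

theorem select_size_le (W : Dat) (P : Dat → Dat → Bool) : (select W P).size ≤ W.size :=
  (Dat.size_ofList_le_of_sublist List.filter_sublist).trans_eq (by rw [Dat.ofList_toList])

theorem foldl_size_le_max {F : Dat → Dat → Dat} {m : ℕ}
    (h : ∀ s a, (F s a).size ≤ max s.size m) (l : List Dat) (s : Dat) :
    (l.foldl F s).size ≤ max s.size m := by
  induction l generalizing s with
  | nil => simp
  | cons a l ih => exact (ih _).trans (max_le (h s a) (le_max_right _ _))

theorem repeated_size_le {F : Dat → Dat} {m : ℕ} (W : Dat)
    (h : ∀ s, (F s).size ≤ max s.size m) (s : Dat) : (repeated W F s).size ≤ max s.size m :=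
  foldl_size_le_max (fun s _ => h s) _ s

/-- The form of `foldl` for states that are selected from `W`: nested iterations do not accumulate
size, because a maximum, unlike a sum, is stable under repetition. -/
theorem polyTime_foldl_of_le_max {F : Dat → Dat → Dat → Dat} {l i : Dat → Dat}
    (hF : PolyTime fun y => F y.head y.tail.head y.tail.tail) (hW : PolyTime W)
    (hB : ∀ x s a, (F x s a).size ≤ max s.size (W x).size)
    (hl : PolyTime l) (hi : PolyTime i) :
    PolyTime fun x => (l x).toList.foldl (F x) (i x) := by
  obtain ⟨q, hq⟩ := hW.size_le
  refine foldl hF ⟨q, fun x s a => (hB x s a).trans (max_le (by omega) ?_)⟩ hl hi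
  have : (W x).size ≤ q.eval (x.size + a.size) := (hq x).trans (eval_mono q (by omega))
  omega

theorem polyTime_repeated {F : Dat → Dat → Dat}
    (hF : PolyTime fun y => F y.head y.tail) (hW : PolyTime W)
    (hB : ∀ x s, (F x s).size ≤ max s.size (W x).size) (hD : PolyTime D) :
    PolyTime fun x => repeated (W x) (F x) (D x) :=
  polyTime_foldl_of_le_max (F := fun x s _ => F x s)
    (hF.comp (f := fun y => .cons y.head y.tail.head) (id.head.cons id.tail.head)) hW
    (fun x s _ => hB x s) hW hD

theorem polyTime_derives (hE : PolyTime E) (hD : PolyTime D) (ha : PolyTime a) (hb : PolyTime b) :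
    PolyTimeTest fun x => derives (E x) (D x) (a x) (b x) := by
  have hD' := hD.comp id.head
  have ha' := ha.comp id.head
  have hb' := hb.comp id.head
  have hz := id.tail
  refine (polyTime_rel hD ha hb).or ((polyTime_meets ha hb).and (any (P := fun x z =>
    (rel (D x) z (a x) && !meets z (b x)) || ((rel (D x) z (b x) && !interSub z (a x) (b x)) ||
      ((rel (D x) (a x) z && !interSub z (b x) (a x)) ||
        (rel (D x) (a x) z && rel (D x) z (b x))))) ?_ hE))
  exact ((polyTime_rel hD' hz ha').and (polyTime_meets hz hb').not).or
    (((polyTime_rel hD' hz hb').and (polyTime_interSub hz ha' hb').not).or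
      (((polyTime_rel hD' ha' hz).and (polyTime_interSub hz hb' ha').not).or
        ((polyTime_rel hD' ha' hz).and (polyTime_rel hD' hz hb'))))

theorem polyTime_close (hE : PolyTime E) (hW : PolyTime W) (hD : PolyTime D) :
    PolyTime fun x => close (E x) (W x) (D x) := by
  refine polyTime_repeated (F := fun x D => select (W x) (derives (E x) D)) ?_ hW
    (fun x s => (select_size_le _ _).trans (le_max_right _ _)) hD
  exact polyTime_select (P := fun y => derives (E y.head) y.tail)
    (polyTime_derives (hE.comp id.head.head) id.head.tail id.tail.head id.tail.tail)
    (hW.comp id.head)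

theorem polyTime_extend (hE : PolyTime E) (hW : PolyTime W) (hD : PolyTime D) (hp : PolyTime p) :
    PolyTime fun x => extend (E x) (W x) (D x) (p x) := by
  refine polyTime_close hE hW (polyTime_select (P := fun x a b => rel (D x) a b ||
    (a == p x && (meets a b && (!(a == b) && !rel (D x) b a)))) ?_ hW)
  have hD' := hD.comp id.head
  have hp' := hp.comp id.head
  have ha : PolyTime fun y : Dat => y.tail.head := id.tail.head
  have hb : PolyTime fun y : Dat => y.tail.tail := id.tail.tail
  exact (polyTime_rel hD' ha hb).or ((eq ha hp').and ((polyTime_meets ha hb).and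
    ((eq ha hb).not.and (polyTime_rel hD' hb ha).not)))

theorem extend_size_le (E W D p : Dat) : (extend E W D p).size ≤ W.size :=
  (repeated_size_le _ (fun _ => (select_size_le _ _).trans (le_max_right _ _)) _).trans
    (max_le (select_size_le _ _) le_rfl)

theorem polyTime_irrefl (hE : PolyTime E) (hD : PolyTime D) :
    PolyTimeTest fun x => irrefl (E x) (D x) :=
  all (P := fun x a => !rel (D x) a a) (polyTime_rel (hD.comp id.head) id.tail id.tail).not hE

theorem polyTime_attempt (hE : PolyTime E) (hW : PolyTime W) (hD : PolyTime D) (hp : PolyTime p) :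
    PolyTime fun x => attempt (E x) (W x) (D x) (p x) :=
  ite (polyTime_irrefl hE (polyTime_extend hE hW hD hp)) (polyTime_extend hE hW hD hp) hD

theorem attempt_size_le (E W D p : Dat) : (attempt E W D p).size ≤ max D.size W.size := by
  unfold attempt
  cases irrefl E (extend E W D p)
  · exact le_max_left _ _
  · exact (extend_size_le _ _ _ _).trans (le_max_right _ _)

theorem polyTime_sweep (hE : PolyTime E) (hW : PolyTime W) (hD : PolyTime D) :
    PolyTime fun x => sweep (E x) (W x) (D x) :=
  polyTime_foldl_of_le_max (F := fun x D p => attempt (E x) (W x) D p)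
    (polyTime_attempt (hE.comp id.head) (hW.comp id.head) id.tail.head id.tail.tail) hW
    (fun _ _ _ => attempt_size_le _ _ _ _) hE hD

theorem polyTime_orient (hE : PolyTime E) (hW : PolyTime W) (he : PolyTime e) :
    PolyTime fun x => orient (E x) (W x) (e x) :=
  polyTime_repeated (F := fun x => sweep (E x) (W x))
    (polyTime_sweep (hE.comp id.head) (hW.comp id.head) id.tail) hW
    (fun _ s => foldl_size_le_max (fun _ _ => attempt_size_le _ _ _ _) _ s)
    (polyTime_extend hE hW nil he)

theorem polyTime_order (hE : PolyTime E) (hW : PolyTime W) (he : PolyTime e) (hD : PolyTime D) :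
    PolyTime fun x => order (E x) (W x) (e x) (D x) := by
  refine polyTime_repeated (F := fun x T => select (W x) fun a b => rel T a b ||
    (E x).toList.any fun z => rel T a z && rel T z b) ?_ hW
    (fun x s => (select_size_le _ _).trans (le_max_right _ _)) ?_
  · refine polyTime_select (P := fun y a b => rel y.tail a b ||
      (E y.head).toList.any fun z => rel y.tail a z && rel y.tail z b) ?_ (hW.comp id.head)
    refine (polyTime_rel id.head.tail id.tail.head id.tail.tail).or
      (any (P := fun u z => rel u.head.tail u.tail.head z && rel u.head.tail z u.tail.tail) ?_
        (hE.comp id.head.head))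
    exact (polyTime_rel id.head.head.tail id.head.tail.head id.tail).and
      (polyTime_rel id.head.head.tail id.tail id.head.tail.tail)
  · refine polyTime_select (P := fun x a b => rel (D x) a b || (a == e x && !(b == e x))) ?_ hW
    exact (polyTime_rel (hD.comp id.head) id.tail.head id.tail.tail).or
      ((eq id.tail.head (he.comp id.head)).and (eq id.tail.tail (he.comp id.head)).not)

theorem polyTime_total (hE : PolyTime E) (hD : PolyTime D) :
    PolyTimeTest fun x => total (E x) (D x) := by
  refine all (P := fun x a => (E x).toList.all fun b =>
    !meets a b || (a == b || (rel (D x) a b || rel (D x) b a))) ?_ hE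
  refine all (P := fun y b => !meets y.tail b ||
    (y.tail == b || (rel (D y.head) y.tail b || rel (D y.head) b y.tail))) ?_ (hE.comp id.head)
  have hD' := hD.comp id.head.head
  exact (polyTime_meets id.head.tail id.tail).not.or ((eq id.head.tail id.tail).or
    ((polyTime_rel hD' id.head.tail id.tail).or (polyTime_rel hD' id.tail id.head.tail)))

theorem polyTime_covering (hE : PolyTime E) (hW : PolyTime W) (hT : PolyTime T) :
    PolyTime fun x => covering (E x) (W x) (T x) := by
  refine polyTime_select (P := fun x a b => rel (T x) a b &&
    (E x).toList.all fun z => !(rel (T x) a z && rel (T x) z b)) ?_ hW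
  refine (polyTime_rel (hT.comp id.head) id.tail.head id.tail.tail).and
    (all (P := fun y z => !(rel (T y.head) y.tail.head z && rel (T y.head) z y.tail.tail)) ?_
      (hE.comp id.head))
  have hT' := hT.comp id.head.head
  exact ((polyTime_rel hT' id.head.tail.head id.tail).and
    (polyTime_rel hT' id.tail id.head.tail.tail)).not

theorem polyTime_findRoot (hE : PolyTime E) (he : PolyTime e) :
    PolyTime fun x => findRoot (E x) (e x) := by
  refine (filter (P := fun x f => (f.toList.all fun v => mem v (e x)) &&
    (e x).toList.all fun v => mem v f) ?_ hE).head
  exact (all (P := fun y v => mem v (e y.head)) (polyTime_mem id.tail (he.comp id.head.head))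
    id.tail).and (all (P := fun y v => mem v y.tail) (polyTime_mem id.tail id.head.tail)
      (he.comp id.head))

theorem polyTime_computeDB : PolyTime computeDB := by
  have hE : PolyTime fun x : Dat => x.head.tail := id.head.tail
  have hW := polyTime_pairs hE
  have he := polyTime_findRoot hE id.tail
  have hD := polyTime_orient hE hW he
  have hT := polyTime_order hE hW he hD
  exact ite ((polyTime_irrefl hE hT).and (polyTime_total hE hD))
    (he.cons (hE.cons (polyTime_covering hE hW hT))) nil

end PolyTime

end Algo
end DisjointBranches

namespace DisjointBranches

/-! ### Correctness of the algorithm -/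

namespace Algo

/-- The set of the entries of an entry of `E`. -/
def entries (E : Dat) (a : {a // a ∈ E.toList}) : Set Dat := {v | v ∈ a.1.toList}

/-- The relation between the entries of `E` that is given by a list of pairs. -/
def Rel (E D : Dat) (a b : {a // a ∈ E.toList}) : Prop := rel D a b = true

theorem mem_iff {a l : Dat} : mem a l = true ↔ a ∈ l.toList := by
  simp [mem]

theorem rel_iff {D a b : Dat} : rel D a b = true ↔ Dat.cons a b ∈ D.toList := mem_iff

theorem meets_iff {E : Dat} {a b : {a // a ∈ E.toList}} :
    meets a b = true ↔ Meet (entries E) a b := by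
  simp [meets, mem_iff, Meet, entries, Set.Nonempty]

theorem interSub_iff {E : Dat} {x z y : {a // a ∈ E.toList}} :
    interSub x z y = true ↔ entries E x ∩ entries E z ⊆ entries E y := by
  simp only [interSub, List.all_eq_true, Bool.or_eq_true, Bool.not_eq_true', ← Bool.not_eq_true,
    mem_iff, entries, Set.subset_def, Set.mem_inter_iff, Set.mem_ofPred_eq, and_imp,
    ← imp_iff_not_or]

theorem toList_pairs (E : Dat) : (pairs E).toList =
    ((E.toList ×ˢ E.toList).map fun p => Dat.cons p.1 p.2).reverse := by
  have h₁ : ∀ (a : Dat) (m : List Dat) (s : Dat),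
      (m.foldl (fun s b => .cons (.cons a b) s) s).toList =
        (m.map (Dat.cons a)).reverse ++ s.toList := by
    intro a m
    induction m with
    | nil => simp
    | cons b m ih => intro s; simp [ih, Dat.toList]
  have h₂ : ∀ (l : List Dat) (s : Dat),
      (l.foldl (fun s a => E.toList.foldl (fun s b => .cons (.cons a b) s) s) s).toList =
        ((l ×ˢ E.toList).map fun p => Dat.cons p.1 p.2).reverse ++ s.toList := by
    intro l
    induction l with
    | nil => simp
    | cons a l ih =>
      intro s
      simp [ih, h₁, List.product_cons, Function.comp_def]
  rw [pairs, h₂]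
  simp [Dat.toList]

theorem mem_pairs {E w : Dat} :
    w ∈ (pairs E).toList ↔ ∃ a ∈ E.toList, ∃ b ∈ E.toList, Dat.cons a b = w := by
  simp only [toList_pairs, List.mem_reverse, List.mem_map, Prod.exists, List.mem_product]
  constructor
  · rintro ⟨a, b, ⟨ha, hb⟩, h⟩; exact ⟨a, ha, b, hb, h⟩
  · rintro ⟨a, ha, b, hb, h⟩; exact ⟨a, b, ⟨ha, hb⟩, h⟩

theorem nodup_pairs {E : Dat} (hE : E.toList.Nodup) : (pairs E).toList.Nodup := by
  rw [toList_pairs, List.nodup_reverse]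
  refine (hE.product hE).map ?_
  rintro ⟨a, b⟩ ⟨c, d⟩ h
  cases h
  rfl

theorem toList_select (W : Dat) (P : Dat → Dat → Bool) :
    (select W P).toList = W.toList.filter fun w => P w.head w.tail := by
  simp [select]

theorem select_sublist (W : Dat) (P : Dat → Dat → Bool) :
    (select W P).toList.Sublist W.toList := by
  rw [toList_select]; exact List.filter_sublist

theorem rel_select {E : Dat} {P : Dat → Dat → Bool} {a b : {a // a ∈ E.toList}} :
    Rel E (select (pairs E) P) a b ↔ P a b = true := by
  rw [Rel, rel_iff, toList_select, List.mem_filter]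
  simp only [Dat.head, Dat.tail, and_iff_right_iff_imp]
  exact fun _ => mem_pairs.mpr ⟨a, a.2, b, b.2, rfl⟩

theorem sublist_select {W D : Dat} {P : Dat → Dat → Bool} (hD : D.toList.Sublist W.toList)
    (h : ∀ w ∈ D.toList, P w.head w.tail = true) : D.toList.Sublist (select W P).toList := by
  rw [toList_select]
  have := hD.filter fun w => P w.head w.tail
  rwa [List.filter_eq_self.mpr h] at this

theorem sublist_select_of_rel {E D : Dat} {P : Dat → Dat → Bool}
    (hD : D.toList.Sublist (pairs E).toList) (h : ∀ a b, rel D a b = true → P a b = true) :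
    D.toList.Sublist (select (pairs E) P).toList := by
  refine sublist_select hD fun w hw => ?_
  obtain ⟨a, -, b, -, rfl⟩ := mem_pairs.mp (hD.subset hw)
  exact h a b (rel_iff.mpr hw)

theorem rel_of_sublist {E D D' : Dat} (h : D.toList.Sublist D'.toList) {a b : {a // a ∈ E.toList}}
    (hab : Rel E D a b) : Rel E D' a b :=
  rel_iff.mpr (h.subset (rel_iff.mp hab))

/-- Relations are compared as sublists rather than as sets of pairs, so that mutual inclusion gives
equality of trees and fixed points can be stated as equations. -/
theorem eq_of_sublist {D D' : Dat} (h : D.toList.Sublist D'.toList)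
    (h' : D'.toList.Sublist D.toList) : D = D' := by
  rw [← D.ofList_toList, ← D'.ofList_toList, h.eq_of_length_le h'.length_le]

theorem repeated_induction {W : Dat} {F : Dat → Dat} {P : Dat → Prop} (h : ∀ s, P s → P (F s))
    {s : Dat} (hs : P s) : P (repeated W F s) := by
  unfold repeated
  induction W.toList generalizing s with
  | nil => exact hs
  | cons a l ih => exact ih (h s hs)

/-- Enlarging a list of pairs as often as there are pairs leads to a fixed point. -/
theorem repeated_fixed {W : Dat} {F : Dat → Dat}
    (h : ∀ s, s.toList.Sublist W.toList →
      s.toList.Sublist (F s).toList ∧ (F s).toList.Sublist W.toList)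
    {s : Dat} (hs : s.toList.Sublist W.toList) :
    F (repeated W F s) = repeated W F s ∧ s.toList.Sublist (repeated W F s).toList ∧
      (repeated W F s).toList.Sublist W.toList := by
  have hfix : ∀ (l : List Dat) (s : Dat), F s = s → l.foldl (fun s _ => F s) s = s := by
    intro l s hs
    induction l with
    | nil => rfl
    | cons a l ih => simpa [hs] using ih
  have key : ∀ (l : List Dat) (s : Dat), s.toList.Sublist W.toList →
      s.toList.Sublist (l.foldl (fun s _ => F s) s).toList ∧
      (l.foldl (fun s _ => F s) s).toList.Sublist W.toList ∧
      (F (l.foldl (fun s _ => F s) s) = l.foldl (fun s _ => F s) s ∨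
        s.toList.length + l.length ≤ (l.foldl (fun s _ => F s) s).toList.length) := by
    intro l
    induction l with
    | nil => exact fun s hs => ⟨List.Sublist.refl _, hs, .inr le_rfl⟩
    | cons a l ih =>
      intro s hs
      obtain ⟨h₁, h₂⟩ := h s hs
      obtain ⟨h₃, h₄, h₅⟩ := ih (F s) h₂
      refine ⟨h₁.trans h₃, h₄, ?_⟩
      by_cases hF : F s = s
      · rw [hfix _ _ hF]; exact .inl hF
      · refine h₅.imp id fun h₅ => ?_
        have : s.toList.length < (F s).toList.length := by
          by_contra hc
          apply hF
          have := congrArg Dat.ofList (h₁.eq_of_length_le (not_lt.mp hc))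
          simpa using this.symm
        simp only [List.foldl_cons, List.length_cons] at h₅ ⊢
        omega
  obtain ⟨h₁, h₂, h₃⟩ := key W.toList s hs
  refine ⟨?_, h₁, h₂⟩
  rcases h₃ with h₃ | h₃
  · exact h₃
  -- If every round made the list longer, it has become all of `W`, where `F` can add nothing.
  · obtain ⟨h₄, h₅⟩ := h _ h₂
    refine (eq_of_sublist h₄ ?_).symm
    rw [show (W.toList.foldl (fun s _ => F s) s).toList = W.toList from
      h₂.eq_of_length_le (by omega)]
    exact h₅

theorem derives_iff {E D : Dat} {a b : {a // a ∈ E.toList}} : derives E D a b = true ↔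
    Rel E D a b ∨ (Meet (entries E) a b ∧ ∃ z,
      (Rel E D z a ∧ ¬ Meet (entries E) z b) ∨
      (Rel E D z b ∧ ¬ entries E z ∩ entries E a ⊆ entries E b) ∨
      (Rel E D a z ∧ ¬ entries E z ∩ entries E b ⊆ entries E a) ∨
      (Rel E D a z ∧ Rel E D z b)) := by
  simp only [derives, Bool.or_eq_true, Bool.and_eq_true, List.any_eq_true, Bool.not_eq_true',
    ← Bool.not_eq_true, Subtype.exists, ← meets_iff, ← interSub_iff, Rel, exists_prop]

/-- Every round is sound for `Closure`, and being a fixed point of `derives` means that all closure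
rules hold. -/
theorem close_spec {E D : Dat} (hD : D.toList.Sublist (pairs E).toList)
    (hm : ∀ a b, Rel E D a b → Meet (entries E) a b) :
    D.toList.Sublist (close E (pairs E) D).toList ∧
      (close E (pairs E) D).toList.Sublist (pairs E).toList ∧
      ∀ a b, Rel E (close E (pairs E) D) a b ↔ Closure (entries E) (Rel E D) a b := by
  obtain ⟨h₁, h₂, h₃⟩ := repeated_fixed (W := pairs E)
    (F := fun D => select (pairs E) (derives E D))
    (fun s hs => ⟨sublist_select_of_rel hs fun a b h => by simp [derives, h],
      select_sublist _ _⟩) hD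
  refine ⟨h₂, h₃, fun a b => ⟨?_, ?_⟩⟩
  · have hind : ∀ a b, Rel E (close E (pairs E) D) a b → Closure (entries E) (Rel E D) a b := by
      refine repeated_induction
        (P := fun s => ∀ a b, Rel E s a b → Closure (entries E) (Rel E D) a b) ?_
        fun a b h => .base h (hm a b h)
      intro s ih a b h
      rw [rel_select, derives_iff] at h
      rcases h with h | ⟨h, z, ⟨h', h''⟩ | ⟨h', h''⟩ | ⟨h', h''⟩ | ⟨h', h''⟩⟩
      · exact ih _ _ h
      · exact .away (ih _ _ h') h h''
      · exact .head (ih _ _ h') h h''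
      · exact .tail (ih _ _ h') h h''
      · exact .trans (ih _ _ h') (ih _ _ h'') h
    exact hind a b
  · have hstep : ∀ a b : {a // a ∈ E.toList}, derives E (close E (pairs E) D) a b = true →
        Rel E (close E (pairs E) D) a b := by
      intro a b h
      have := rel_select.mpr h
      rwa [show select (pairs E) (derives E (close E (pairs E) D)) = close E (pairs E) D from h₁]
        at this
    intro h
    induction h with
    | base h _ => exact rel_of_sublist h₂ h
    | away _ h₁ h₂ ih => exact hstep _ _ (derives_iff.mpr (.inr ⟨h₁, _, .inl ⟨ih, h₂⟩⟩))
    | head _ h₁ h₂ ih => exact hstep _ _ (derives_iff.mpr (.inr ⟨h₁, _, .inr (.inl ⟨ih, h₂⟩)⟩))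
    | tail _ h₁ h₂ ih =>
      exact hstep _ _ (derives_iff.mpr (.inr ⟨h₁, _, .inr (.inr (.inl ⟨ih, h₂⟩))⟩))
    | trans _ _ h ih₁ ih₂ =>
      exact hstep _ _ (derives_iff.mpr (.inr ⟨h, _, .inr (.inr (.inr ⟨ih₁, ih₂⟩))⟩))

theorem extend_sublist {E D : Dat} (hD : D.toList.Sublist (pairs E).toList)
    (p : Dat) : D.toList.Sublist (extend E (pairs E) D p).toList ∧
      (extend E (pairs E) D p).toList.Sublist (pairs E).toList := by
  obtain ⟨-, h₂, h₃⟩ := repeated_fixed (W := pairs E)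
    (F := fun D => select (pairs E) (derives E D))
    (fun s hs => ⟨sublist_select_of_rel hs fun a b h => by simp [derives, h],
      select_sublist _ _⟩) (select_sublist (pairs E) fun a b =>
        rel D a b || (a == p && (meets a b && (!(a == b) && !rel D b a))))
  exact ⟨(sublist_select_of_rel hD fun a b h => by simp [h]).trans h₂, h₃⟩

theorem rel_extend {E D : Dat} (hC : Closed (entries E) (Rel E D)) (p a b : {a // a ∈ E.toList}) :
    Rel E (extend E (pairs E) D p) a b ↔
      Closure (entries E) (SourceAt (entries E) (Rel E D) p) a b := by
  have hsel : ∀ a b, Rel E (select (pairs E) fun a b =>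
      rel D a b || (a == p && (meets a b && (!(a == b) && !rel D b a)))) a b ↔
      SourceAt (entries E) (Rel E D) p a b := by
    intro a b
    rw [rel_select]
    simp only [Bool.or_eq_true, Bool.and_eq_true, beq_iff_eq, Bool.not_eq_true', meets_iff,
      beq_eq_false_iff_ne, ← Bool.not_eq_true (rel D b a), SourceAt, Open, ← Subtype.ext_iff, Rel,
      ne_eq]
    tauto
  have hm : ∀ a b, Rel E (select (pairs E) fun a b =>
      rel D a b || (a == p && (meets a b && (!(a == b) && !rel D b a)))) a b →
      Meet (entries E) a b := by
    intro a b h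
    rcases (hsel a b).mp h with h | h
    · exact hC.meet h
    · exact h.2.1
  rw [extend, (close_spec (select_sublist _ _) hm).2.2, show Rel E (select _ _) = _ from
    funext fun a => funext fun b => propext (hsel a b)]

theorem irrefl_iff {E D : Dat} : irrefl E D = true ↔ ∀ a, ¬ Rel E D a a := by
  simp [irrefl, Rel]

theorem total_iff {E D : Dat} : total E D = true ↔
    ∀ a b, Meet (entries E) a b → a ≠ b → Rel E D a b ∨ Rel E D b a := by
  have : ∀ a b : {a // a ∈ E.toList},
      (!meets a b || (a.1 == b.1 || (rel D a b || rel D b a))) = true ↔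
      (Meet (entries E) a b → a ≠ b → Rel E D a b ∨ Rel E D b a) := by
    intro a b
    rw [← meets_iff, ne_eq, Subtype.ext_iff]
    simp only [Bool.or_eq_true, Bool.not_eq_true', ← Bool.not_eq_true, beq_iff_eq, Rel]
    tauto
  simp only [← this, total, List.all_eq_true, Subtype.forall]

theorem attempt_sublist {E D : Dat} (hD : D.toList.Sublist (pairs E).toList) (p : Dat) :
    D.toList.Sublist (attempt E (pairs E) D p).toList ∧
      (attempt E (pairs E) D p).toList.Sublist (pairs E).toList := by
  unfold attempt
  cases irrefl E (extend E (pairs E) D p)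
  · exact ⟨List.Sublist.refl _, hD⟩
  · exact extend_sublist hD p

/-- Attempts never remove pairs, so a sweep that returns its input has not changed it at any moment;
every attempt was thus made on `D` itself. -/
theorem foldl_attempt {E : Dat} (l : List Dat) {D : Dat}
    (hD : D.toList.Sublist (pairs E).toList) :
    D.toList.Sublist (l.foldl (fun D p => attempt E (pairs E) D p) D).toList ∧
      (l.foldl (fun D p => attempt E (pairs E) D p) D).toList.Sublist (pairs E).toList ∧
      (l.foldl (fun D p => attempt E (pairs E) D p) D = D →
        ∀ p ∈ l, attempt E (pairs E) D p = D) := by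
  induction l generalizing D with
  | nil => exact ⟨List.Sublist.refl _, hD, by simp⟩
  | cons a l ih =>
    obtain ⟨h₁, h₂⟩ := attempt_sublist hD a
    obtain ⟨h₃, h₄, h₅⟩ := ih h₂
    refine ⟨h₁.trans h₃, h₄, fun h => ?_⟩
    rw [List.foldl_cons] at h
    have ha : attempt E (pairs E) D a = D := by
      rw [h] at h₃
      exact eq_of_sublist h₃ h₁
    rw [ha] at h h₅
    intro p hp
    rcases List.mem_cons.mp hp with rfl | hp
    · exact ha
    · exact h₅ h p hp

/-- The states of the algorithm: closed relations, which are contained in an orientation if there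
is one that contains the relation at the start. -/
theorem attempt_invariant {E D : Dat} (hC : Closed (entries E) (Rel E D))
    (p : {a // a ∈ E.toList}) :
    Closed (entries E) (Rel E (attempt E (pairs E) D p)) ∧
      ((∃ L, Orientation (entries E) L ∧ ∀ a b, Rel E D a b → L a b) →
        ∃ L, Orientation (entries E) L ∧ ∀ a b, Rel E (attempt E (pairs E) D p) a b → L a b) := by
  unfold attempt
  cases hi : irrefl E (extend E (pairs E) D p)
  · exact ⟨hC, id⟩
  · have heq : Rel E (extend E (pairs E) D p) =
        Closure (entries E) (SourceAt (entries E) (Rel E D) p) :=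
      funext fun a => funext fun b => propext (rel_extend hC p a b)
    rw [irrefl_iff, heq] at hi
    rw [cond_true, heq]
    exact ⟨Closure.closed _, fun ⟨L, hL, hDL⟩ => exists_orientation_of_sourceAt hC hL hDL hi⟩

theorem rel_nil {E : Dat} (a b : {a // a ∈ E.toList}) : ¬ Rel E .nil a b := by
  simp [Rel, rel_iff, Dat.toList]

theorem closed_nil {E : Dat} : Closed (entries E) (Rel E .nil) := by
  constructor <;> intros <;> exact absurd ‹_› (rel_nil _ _)

theorem rel_extend_nil {E : Dat} (e : {a // a ∈ E.toList}) {b : {a // a ∈ E.toList}}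
    (hm : Meet (entries E) e b) (hne : e ≠ b) : Rel E (extend E (pairs E) .nil e) e b :=
  (rel_extend closed_nil _ _ _).mpr
    (.base (.inr ⟨rfl, hm, hne, rel_nil _ _, rel_nil _ _⟩) hm)

/-- The containing orientation `L` may change with each accepted attempt and need not come from the
given order `lt`; only its existence is an invariant. -/
theorem orient_spec {E : Dat} (e : {a // a ∈ E.toList}) :
    Closed (entries E) (Rel E (orient E (pairs E) e)) ∧
      ∀ lt, BranchOrder (entries E) e lt →
        (∀ a b, Meet (entries E) a b → a ≠ b →
          Rel E (orient E (pairs E) e) a b ∨ Rel E (orient E (pairs E) e) b a) ∧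
        ∀ x, ¬ Relation.TransGen (WithRoot (Rel E (orient E (pairs E) e)) e) x x := by
  have hsub : (extend E (pairs E) .nil e).toList.Sublist (pairs E).toList :=
    (extend_sublist (D := .nil) (List.nil_sublist _) _).2
  obtain ⟨hfix, hle, hW⟩ := repeated_fixed (W := pairs E) (F := sweep E (pairs E))
    (fun s hs => ⟨(foldl_attempt _ hs).1, (foldl_attempt _ hs).2.1⟩) hsub
  change sweep E (pairs E) (orient E (pairs E) e) = orient E (pairs E) e at hfix
  have hinv : ∀ {P : Dat → Prop}, (∀ D (p : {a // a ∈ E.toList}), P D →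
      P (attempt E (pairs E) D p)) → P (extend E (pairs E) .nil e) →
      P (orient E (pairs E) e) := by
    intro P hP h₀
    refine repeated_induction (fun s hs => ?_) h₀
    have : ∀ (l : List Dat) (s : Dat), (∀ p ∈ l, p ∈ E.toList) → P s →
        P (l.foldl (fun D p => attempt E (pairs E) D p) s) := by
      intro l
      induction l with
      | nil => exact fun s _ h => h
      | cons a l ih =>
        exact fun s hl hs => ih _ (fun p hp => hl p (by simp [hp]))
          (hP s ⟨a, hl a (by simp)⟩ hs)
    exact this E.toList s (fun _ h => h) hs
  have hC₀ : Closed (entries E) (Rel E (extend E (pairs E) .nil e)) := by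
    rw [show Rel E (extend E (pairs E) .nil e) = _ from
      funext fun a => funext fun b => propext (rel_extend closed_nil e a b)]
    exact Closure.closed _
  have hC : Closed (entries E) (Rel E (orient E (pairs E) e)) :=
    hinv (P := fun D => Closed (entries E) (Rel E D)) (fun D p h => (attempt_invariant h p).1) hC₀
  refine ⟨hC, fun lt hlt => ?_⟩
  obtain ⟨-, L, hL, hDL⟩ := hinv (P := fun D => Closed (entries E) (Rel E D) ∧
    ∃ L, Orientation (entries E) L ∧ ∀ a b, Rel E D a b → L a b)
    (fun D p h => ⟨(attempt_invariant h.1 p).1, (attempt_invariant h.1 p).2 h.2⟩)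
    ⟨hC₀, _, hlt.orientation, fun a b h => by
      refine ((rel_extend closed_nil e a b).mp h).le hlt.orientation.toClosed ?_
      rintro x y (h | ⟨rfl, ho⟩) hm
      · exact absurd h (rel_nil _ _)
      · exact ⟨hlt.root ho.2.1.symm, hm⟩⟩
  have htot : ∀ a b, Meet (entries E) a b → a ≠ b →
      Rel E (orient E (pairs E) e) a b ∨ Rel E (orient E (pairs E) e) b a := by
    intro a b hm hne
    by_contra hc
    rw [not_or] at hc
    -- The attempt at `p` stays inside `L`, so it is accepted; at a fixed point it adds nothing,
    -- although it would settle the open pair `(p, q)`.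
    obtain ⟨p, q, hpq, hle'⟩ := exists_sourceAt_le hL hDL ⟨hm, hne, hc.1, hc.2⟩
    have hat : attempt E (pairs E) (orient E (pairs E) e) p = orient E (pairs E) e :=
      (foldl_attempt E.toList hW).2.2 hfix p p.2
    rw [attempt, show irrefl E (extend E (pairs E) (orient E (pairs E) e) p) = true from
      irrefl_iff.mpr fun x hx => hL.irrefl x (hle' _ _ ((rel_extend hC p x x).mp hx)),
      cond_true] at hat
    apply hpq.2.2.1
    rw [← hat, rel_extend hC]
    exact .base (.inr ⟨rfl, hpq⟩) hpq.1
  refine ⟨htot, ?_⟩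
  -- The initial relation already directs all intersecting pairs at `e` away from `e`. A cycle of
  -- `WithRoot` therefore avoids `e` and would be a cycle of `L`.
  have hnot : ∀ x, ¬ WithRoot (Rel E (orient E (pairs E) e)) e x e := by
    rintro x (h | h)
    · have hne : e ≠ x := by rintro rfl; exact hL.irrefl _ (hDL _ _ h)
      exact hL.asymm (hDL _ _ h)
        (hDL _ _ (rel_of_sublist hle (rel_extend_nil e (hC.meet h).symm hne)))
    · exact h.2 rfl
  have hnot' : ∀ x, ¬ Relation.TransGen (WithRoot (Rel E (orient E (pairs E) e)) e) x e := by
    intro x h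
    obtain ⟨y, -, hy⟩ := Relation.TransGen.tail'_iff.mp h
    exact hnot y hy
  have hlift : ∀ {x y}, Relation.TransGen (WithRoot (Rel E (orient E (pairs E) e)) e) x y →
      x ≠ e → Relation.TransGen L x y := by
    intro x y h
    induction h using Relation.TransGen.head_induction_on with
    | single h => exact fun hx => .single (hDL _ _ (h.resolve_right fun h => hx h.1))
    | head h _ ih =>
      intro hx
      refine .head (hDL _ _ (h.resolve_right fun h => hx h.1)) (ih ?_)
      rintro rfl
      exact hnot _ h
  intro x hx
  by_cases hxe : x = e
  · subst hxe; exact hnot' _ hx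
  · exact hL.acyclic x (hlift hx hxe)

theorem rel_order {E : Dat} (e : {a // a ∈ E.toList}) (D : Dat) :
    Rel E (order E (pairs E) e D) = Relation.TransGen (WithRoot (Rel E D) e) := by
  have hbase : ∀ a b, Rel E (select (pairs E) fun a b =>
      rel D a b || (a == e.1 && !(b == e.1))) a b ↔ WithRoot (Rel E D) e a b := by
    intro a b
    rw [rel_select]
    simp only [Bool.or_eq_true, Bool.and_eq_true, beq_iff_eq, Bool.not_eq_true',
      beq_eq_false_iff_ne, WithRoot, Subtype.ext_iff, Rel, ne_eq]
  have hstep : ∀ T a b, Rel E (select (pairs E) fun a b =>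
      rel T a b || E.toList.any fun z => rel T a z && rel T z b) a b ↔
      Rel E T a b ∨ ∃ z, Rel E T a z ∧ Rel E T z b := by
    intro T a b
    rw [rel_select]
    simp only [Bool.or_eq_true, Bool.and_eq_true, List.any_eq_true, Subtype.exists, Rel,
      exists_prop]
  obtain ⟨h₁, h₂, -⟩ := repeated_fixed (W := pairs E)
    (F := fun T => select (pairs E) fun a b =>
      rel T a b || E.toList.any fun z => rel T a z && rel T z b)
    (fun s hs => ⟨sublist_select_of_rel hs fun a b h => by simp [h], select_sublist _ _⟩)
    (select_sublist (pairs E) fun a b => rel D a b || (a == e.1 && !(b == e.1)))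
  funext a b
  refine propext ⟨?_, fun h => ?_⟩
  · have : ∀ a b, Rel E (order E (pairs E) e D) a b →
        Relation.TransGen (WithRoot (Rel E D) e) a b := by
      refine repeated_induction
        (P := fun s => ∀ a b, Rel E s a b → Relation.TransGen (WithRoot (Rel E D) e) a b) ?_
        fun a b h => .single ((hbase a b).mp h)
      intro s ih a b h
      rcases (hstep s a b).mp h with h | ⟨z, h, h'⟩
      · exact ih _ _ h
      · exact (ih _ _ h).trans (ih _ _ h')
    exact this a b
  · have hs : ∀ {a b}, WithRoot (Rel E D) e a b → Rel E (order E (pairs E) e D) a b :=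
      fun h => rel_of_sublist h₂ ((hbase _ _).mpr h)
    induction h with
    | single h => exact hs h
    | @tail b c _ h ih =>
      have := (hstep (order E (pairs E) e D) a c).mpr (.inr ⟨b, ih, hs h⟩)
      exact (congrFun (congrFun (congrArg (Rel E) h₁) a) c) ▸ this

/-- The two tests are the hypotheses of `branchOrder_of_closed` that `orient_spec` guarantees only
when an ancestor order exists. -/
theorem accept_iff {E : Dat} (e : {a // a ∈ E.toList}) :
    (irrefl E (order E (pairs E) e (orient E (pairs E) e)) &&
      total E (orient E (pairs E) e)) = true ↔ ∃ lt, BranchOrder (entries E) e lt := by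
  have : Finite {a // a ∈ E.toList} := List.finite_toSet _
  obtain ⟨hC, h⟩ := orient_spec e
  rw [Bool.and_eq_true, irrefl_iff, total_iff, rel_order]
  exact ⟨fun h' => ⟨_, branchOrder_of_closed hC h'.2 h'.1⟩,
    fun ⟨lt, hlt⟩ => ⟨(h lt hlt).2, (h lt hlt).1⟩⟩

theorem branchOrder_of_accept {E : Dat} (e : {a // a ∈ E.toList})
    (h : (irrefl E (order E (pairs E) e (orient E (pairs E) e)) &&
      total E (orient E (pairs E) e)) = true) :
    BranchOrder (entries E) e (Rel E (order E (pairs E) e (orient E (pairs E) e))) := by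
  have : Finite {a // a ∈ E.toList} := List.finite_toSet _
  rw [Bool.and_eq_true, irrefl_iff, total_iff, rel_order] at h
  rw [rel_order]
  exact branchOrder_of_closed (orient_spec e).1 h.2 h.1

theorem rel_covering {E T : Dat} {a b : {a // a ∈ E.toList}} :
    Dat.cons a b ∈ (covering E (pairs E) T).toList ↔ Covers (Rel E T) a b := by
  rw [← rel_iff]
  refine (rel_select (E := E)).trans ?_
  simp only [Covers, Rel, Bool.and_eq_true, List.all_eq_true, Bool.not_eq_true', Subtype.forall,
    ← Bool.not_eq_true, not_and]

theorem covering_sublist {E T : Dat} :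
    (covering E (pairs E) T).toList.Sublist (pairs E).toList := select_sublist _ _

end Algo
end DisjointBranches

namespace DisjointBranches

/-! ### Representations -/

/-- The laws involve the sets only through meeting and inclusion of intersections. So the elements
may change type, from codes of vertices to vertices and back. -/
theorem BranchOrder.comap {ι κ α β : Type*} {A : ι → Set α} {B : κ → Set β} {e : ι}
    {lt : ι → ι → Prop} (h : BranchOrder A e lt) (φ : κ ≃ ι)
    (hm : ∀ x y, Meet B x y → Meet A (φ x) (φ y))
    (hc : ∀ x y z, A (φ x) ∩ A (φ z) ⊆ A (φ y) → B x ∩ B z ⊆ B y) :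
    BranchOrder B (φ.symm e) fun x y => lt (φ x) (φ y) where
  irrefl x := h.irrefl _
  trans := h.trans
  root {x} hx := by
    rw [φ.apply_symm_apply]
    exact h.root fun h' => hx (by rw [← h', φ.symm_apply_apply])
  chain h₁ h₂ := (h.chain h₁ h₂).imp (fun h => φ.injective h) id
  comparable hxy hne := h.comparable (hm _ _ hxy) (φ.injective.ne hne)
  convex h₁ h₂ := hc _ _ _ (h.convex h₁ h₂)

theorem ofNat_injective : Function.Injective Dat.ofNat := by
  intro m n h
  have h₁ := congrArg Dat.toList h
  simp only [Dat.ofNat, Dat.toList_ofList] at h₁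
  have h₂ : Function.Injective Dat.ofBool := by
    intro b c h
    cases b <;> cases c <;> simp_all [Dat.ofBool]
  have h₃ := List.map_injective_iff.mpr h₂ h₁
  have hbits : ∀ n : ℕ, n.bits.foldr Nat.bit 0 = n := by
    intro n
    induction n using Nat.binaryRec' with
    | zero => simp
    | bit b n h ih => rw [Nat.bits_append_bit _ _ h, List.foldr_cons, ih]
  rw [← hbits m, ← hbits n, h₃]

/-- The set of numbers that is represented by a tree. -/
def decode (d : Dat) : Set ℕ := {n | Dat.ofNat n ∈ d.toList}

theorem decode_of_repSet {d : Dat} {S : Set ℕ} (h : RepSet RepNat d S) :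
    decode d = S ∧ ∀ v ∈ d.toList, ∃ n, Dat.ofNat n = v := by
  obtain ⟨l, ds, -, hl, hds, rfl⟩ := h
  have : ds = l.map Dat.ofNat := by
    clear hl
    induction hds with
    | nil => rfl
    | cons h _ ih => rw [List.map_cons, ← ih, h]
  subst this
  constructor
  · ext n
    simp only [decode, Dat.toList_ofList, Set.mem_ofPred_eq, List.mem_map, ← hl]
    exact ⟨fun ⟨m, hm, h⟩ => ofNat_injective h ▸ hm, fun h => ⟨n, h, rfl⟩⟩
  · intro v hv
    simp only [Dat.toList_ofList, List.mem_map] at hv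
    exact hv.imp fun n h => h.2

theorem decode_of_repSet_repSet {d : Dat} {S : Set (Set ℕ)} (h : RepSet (RepSet RepNat) d S) :
    (d.toList.map decode).Nodup ∧ (∀ s, s ∈ d.toList.map decode ↔ s ∈ S) ∧
      ∀ a ∈ d.toList, RepSet RepNat a (decode a) := by
  obtain ⟨l, ds, hnd, hl, hds, rfl⟩ := h
  have : l = ds.map decode ∧ ∀ a ∈ ds, RepSet RepNat a (decode a) := by
    clear hl hnd
    induction hds with
    | nil => simp
    | cons h _ ih =>
      obtain ⟨h', -⟩ := decode_of_repSet h
      refine ⟨by rw [List.map_cons, h', ← ih.1], ?_⟩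
      intro a ha
      rcases List.mem_cons.mp ha with rfl | ha
      · rwa [h']
      · exact ih.2 a ha
  rw [Dat.toList_ofList, ← this.1]
  exact ⟨hnd, hl, this.2⟩

theorem repSet_of_bijOn {β : Type} {Rep : Dat → β → Prop} {S : Set β} {d : Dat}
    (f : {a // a ∈ d.toList} → β) (hd : d.toList.Nodup) (hf : Function.Injective f)
    (hS : Set.range f = S) (hrep : ∀ a : {a // a ∈ d.toList}, Rep a (f a)) : RepSet Rep d S := by
  refine ⟨d.toList.attach.map f, d.toList, (List.nodup_attach.mpr hd).map hf, ?_, ?_,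
    d.ofList_toList.symm⟩
  · intro b
    simp [← hS]
  · have h : List.Forall₂ Rep (d.toList.attach.map Subtype.val) (d.toList.attach.map f) := by
      rw [List.forall₂_map_left_iff, List.forall₂_map_right_iff]
      exact List.forall₂_same.mpr fun a _ => hrep a
    rwa [List.attach_map_subtype_val] at h

/-! ### Hyperedges and the list entries that represent them -/

namespace Algo

section

variable {H : Hypergraph ℕ} {E : Dat} (hE : RepSet (RepSet RepNat) E H.edgeSet)
include hE

theorem nodup_of_rep : E.toList.Nodup := (decode_of_repSet_repSet hE).1.of_map _

theorem decode_mem {a : Dat} (ha : a ∈ E.toList) : decode a ∈ H.edgeSet :=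
  ((decode_of_repSet_repSet hE).2.1 _).mp (List.mem_map_of_mem ha)

/-- The entries of a list of hyperedges correspond to the hyperedges. -/
noncomputable def edgeEquiv : {a // a ∈ E.toList} ≃ H.edgeSet :=
  Equiv.ofBijective (fun a => ⟨decode a, decode_mem hE a.2⟩) (by
    obtain ⟨h₁, h₂, -⟩ := decode_of_repSet_repSet hE
    constructor
    · intro a b hab
      exact Subtype.ext (List.inj_on_of_nodup_map h₁ a.2 b.2 (congrArg Subtype.val hab))
    · rintro ⟨s, hs⟩
      obtain ⟨a, ha, rfl⟩ := List.mem_map.mp ((h₂ s).mpr hs)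
      exact ⟨⟨a, ha⟩, rfl⟩)

theorem edgeEquiv_apply (a : {a // a ∈ E.toList}) : (edgeEquiv hE a : Set ℕ) = decode a := rfl

theorem entries_eq (a : {a // a ∈ E.toList}) :
    entries E a = Dat.ofNat '' (edgeEquiv hE a : Set ℕ) := by
  ext v
  rw [edgeEquiv_apply]
  constructor
  · intro hv
    obtain ⟨n, rfl⟩ := (decode_of_repSet ((decode_of_repSet_repSet hE).2.2 a a.2)).2 v hv
    exact ⟨n, hv, rfl⟩
  · rintro ⟨n, hn, rfl⟩
    exact hn

theorem meet_entries (a b : {a // a ∈ E.toList}) :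
    Meet (entries E) a b ↔
      Meet (fun x : H.edgeSet => (x : Set ℕ)) (edgeEquiv hE a) (edgeEquiv hE b) := by
  rw [Meet, Meet, entries_eq hE, entries_eq hE, ← Set.image_inter ofNat_injective,
    Set.image_nonempty]

theorem inter_subset_entries (a b c : {a // a ∈ E.toList}) :
    entries E a ∩ entries E b ⊆ entries E c ↔
      (edgeEquiv hE a : Set ℕ) ∩ edgeEquiv hE b ⊆ edgeEquiv hE c := by
  rw [entries_eq hE, entries_eq hE, entries_eq hE, ← Set.image_inter ofNat_injective,
    Set.image_subset_image_iff ofNat_injective]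

/-- The input may list the vertices of the root in another order than its entry in `E`, so equality
of trees would be too strict a test. -/
theorem findRoot_spec {r : Dat} {e : Set ℕ} (he : e ∈ H.edgeSet) (hr : RepSet RepNat r e) :
    ∃ e' : {a // a ∈ E.toList}, e'.1 = findRoot E r ∧ decode e' = e := by
  obtain ⟨hr₁, hr₂⟩ := decode_of_repSet hr
  obtain ⟨-, hmem, hrep⟩ := decode_of_repSet_repSet hE
  have hP : ∀ f ∈ E.toList, ((f.toList.all fun v => mem v r) &&
      r.toList.all fun v => mem v f) = true ↔ decode f = e := by
    intro f hf
    have hf' := (decode_of_repSet (hrep f hf)).2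
    simp only [Bool.and_eq_true, List.all_eq_true, mem_iff, ← hr₁, Set.ext_iff, decode,
      Set.mem_ofPred_eq]
    constructor
    · exact fun h n => ⟨h.1 _, h.2 _⟩
    · intro h
      constructor <;> intro v hv
      · obtain ⟨n, rfl⟩ := hf' v hv
        exact (h n).mp hv
      · obtain ⟨n, rfl⟩ := hr₂ v hv
        exact (h n).mpr hv
  obtain ⟨f, hf, hfe⟩ := List.mem_map.mp ((hmem e).mpr he)
  unfold findRoot
  cases hl : E.toList.filter fun f =>
      (f.toList.all fun v => mem v r) && r.toList.all fun v => mem v f with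
  | nil =>
    rw [List.filter_eq_nil_iff] at hl
    exact absurd ((hP f hf).mpr hfe) (hl f hf)
  | cons g l =>
    have hg : g ∈ E.toList.filter fun f =>
        (f.toList.all fun v => mem v r) && r.toList.all fun v => mem v f := by simp [hl]
    rw [List.mem_filter] at hg
    exact ⟨⟨g, hg.1⟩, rfl, (hP g hg.1).mp hg.2⟩

theorem exists_branchOrder (D : Decomposition H) {e : {a // a ∈ E.toList}}
    (he : D.RootedIn (decode e)) : ∃ lt, BranchOrder (entries E) e lt := by
  have h := D.branchOrder.comap (B := entries E) (edgeEquiv hE)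
    (fun x y => (meet_entries hE x y).mp) (fun x y z => (inter_subset_entries hE x z y).mpr)
  have he' : (edgeEquiv hE).symm (D.label D.root) = e := by
    rw [Equiv.symm_apply_eq]
    exact Subtype.ext he
  rw [he'] at h
  exact ⟨_, h⟩

theorem exists_decomposition {e : {a // a ∈ E.toList}} {T : Dat}
    (hT : BranchOrder (entries E) e (Rel E T)) :
    ∃ D : Decomposition H, D.RootedIn (decode e) ∧
      RepDecomposition (.cons e (.cons E (covering E (pairs E) T))) D := by
  have : Finite {a // a ∈ E.toList} := List.finite_toSet _
  have : Finite H.edgeSet := Finite.of_equiv _ (edgeEquiv hE)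
  have hrep : ∀ a : {a // a ∈ E.toList}, RepSet RepNat a (edgeEquiv hE a : Set ℕ) :=
    fun a => (decode_of_repSet_repSet hE).2.2 a a.2
  have h := hT.comap (B := fun x : H.edgeSet => (x : Set ℕ)) (edgeEquiv hE).symm
    (fun x y => by simpa using (meet_entries hE ((edgeEquiv hE).symm x) ((edgeEquiv hE).symm y)).mpr)
    (fun x y z => by simpa using (inter_subset_entries hE ((edgeEquiv hE).symm x)
      ((edgeEquiv hE).symm z) ((edgeEquiv hE).symm y)).mp)
  rw [Equiv.symm_symm] at h
  refine ⟨h.decomposition, rfl, _, _, _, hrep e, ?_, ?_, rfl⟩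
  · exact repSet_of_bijOn (edgeEquiv hE) (nodup_of_rep hE) (edgeEquiv hE).injective
      (Set.range_eq_univ.mpr (edgeEquiv hE).surjective) hrep
  · have hcov : ∀ w : {w // w ∈ (covering E (pairs E) T).toList},
        ∃ a b : {a // a ∈ E.toList}, w.1 = .cons a b ∧ Covers (Rel E T) a b := by
      rintro ⟨w, hw⟩
      obtain ⟨a, ha, b, hb, rfl⟩ := mem_pairs.mp (covering_sublist.subset hw)
      exact ⟨⟨a, ha⟩, ⟨b, hb⟩, rfl, rel_covering.mp hw⟩
    choose fst snd hw hc using hcov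
    refine repSet_of_bijOn (fun w => s(edgeEquiv hE (fst w), edgeEquiv hE (snd w)))
      ((nodup_pairs (nodup_of_rep hE)).sublist covering_sublist) ?_ ?_ ?_
    · intro w w' hww
      refine Subtype.ext ?_
      rw [hw, hw]
      rcases Sym2.eq_iff.mp hww with ⟨h₁, h₂⟩ | ⟨h₁, h₂⟩
      · rw [(edgeEquiv hE).injective h₁, (edgeEquiv hE).injective h₂]
      -- Two covering pairs that are reverse to each other would violate the asymmetry of the order,
      -- so no edge of the tree is listed twice.
      · have l₁ := (hc w).1
        have l₂ := (hc w').1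
        rw [← (edgeEquiv hE).injective h₁, ← (edgeEquiv hE).injective h₂] at l₂
        exact absurd (hT.trans l₁ l₂) (hT.irrefl _)
    · have hcovers : ∀ x y, Covers (fun x y => Rel E T ((edgeEquiv hE).symm x)
          ((edgeEquiv hE).symm y)) x y ↔
          Covers (Rel E T) ((edgeEquiv hE).symm x) ((edgeEquiv hE).symm y) := by
        intro x y
        simp only [Covers, (edgeEquiv hE).symm.forall_congr_left, Equiv.symm_symm,
          Equiv.symm_apply_apply]
      have hlift : ∀ x y, Covers (Rel E T) ((edgeEquiv hE).symm x) ((edgeEquiv hE).symm y) →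
          ∃ w, s(edgeEquiv hE (fst w), edgeEquiv hE (snd w)) = s(x, y) := by
        intro x y hxy
        refine ⟨⟨_, rel_covering.mpr hxy⟩, ?_⟩
        have := hw ⟨_, rel_covering.mpr hxy⟩
        simp only [Dat.cons.injEq, ← Subtype.ext_iff] at this
        rw [← this.1, ← this.2, Equiv.apply_symm_apply, Equiv.apply_symm_apply]
      ext z
      constructor
      · rintro ⟨w, rfl⟩
        refine h.adj_of_covers ((hcovers _ _).mpr ?_)
        simpa using hc w
      · induction z with
        | _ x y =>
          intro hxy
          rcases (show (coverGraph _).Adj x y from hxy).2 with h' | h'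
          · exact hlift x y ((hcovers _ _).mp h')
          · rw [Sym2.eq_swap]
            exact hlift y x ((hcovers _ _).mp h')
    · intro w
      exact ⟨_, _, _, _, rfl, hrep _, hrep _, hw w⟩

end

end Algo

end DisjointBranches

/-! ### The main theorem -/

theorem mainTheorem2 :
    ∃ (ComputeDB : DisjointBranches.Prog) (q : Polynomial ℕ),
      ∀ (H : Hypergraph ℕ) (e : Set ℕ) (x : DisjointBranches.Dat),
        H.vertexSet.Finite → e ∈ H.edgeSet → DisjointBranches.RepInstance x H e →
        ∃ (y : DisjointBranches.Dat) (t : ℕ),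
          ComputeDB.Run x y t ∧ t ≤ q.eval x.size ∧
          ((∃ D : DisjointBranches.Decomposition H, D.RootedIn e) →
            ∃ D : DisjointBranches.Decomposition H,
              D.RootedIn e ∧ DisjointBranches.RepDecomposition y D) ∧
          ((¬ ∃ D : DisjointBranches.Decomposition H, D.RootedIn e) →
            y = DisjointBranches.reject) := by
  obtain ⟨p, q, hp⟩ := DisjointBranches.Algo.polyTime_computeDB
  refine ⟨p, q, ?_⟩
  rintro H e _ - he ⟨_, r, ⟨dV, E, -, hE, rfl⟩, hr, rfl⟩
  obtain ⟨t, ht, hq⟩ := hp (.cons (.cons dV E) r)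
  refine ⟨_, t, ht, hq, ?_⟩
  obtain ⟨e', he', rfl⟩ := DisjointBranches.Algo.findRoot_spec hE he hr
  simp only [DisjointBranches.Algo.computeDB, DisjointBranches.Algo.compute,
    DisjointBranches.Algo.output, DisjointBranches.Dat.head, DisjointBranches.Dat.tail, ← he']
  have hiff := DisjointBranches.Algo.accept_iff e'
  cases hacc : (DisjointBranches.Algo.irrefl E (DisjointBranches.Algo.order E
    (DisjointBranches.Algo.pairs E) e' (DisjointBranches.Algo.orient E
      (DisjointBranches.Algo.pairs E) e')) && DisjointBranches.Algo.total E
        (DisjointBranches.Algo.orient E (DisjointBranches.Algo.pairs E) e'))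
  · refine ⟨fun ⟨D, hD⟩ => ?_, fun _ => rfl⟩
    have := hiff.mpr (DisjointBranches.Algo.exists_branchOrder hE D hD)
    rw [hacc] at this
    cases this
  · have hD := DisjointBranches.Algo.exists_decomposition hE
      (DisjointBranches.Algo.branchOrder_of_accept e' hacc)
    exact ⟨fun _ => hD, fun h => absurd (hD.imp fun D hD => hD.1) h⟩
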